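/- **Setting.** A power network has buses $1,\dots,n$, joined by lines that form a simple graph; $\ell\sim k$ means that a line joins $k$ and $\ell$. The line has admittance $y_{k\ell}=y_{\ell k}\in\mathbb C\setminus\{0\}$, impedance $1/y_{k\ell}=r_{k\ell}+\mathbf i x_{k\ell}$ and real power flow limit $f_{k\ell}=f_{\ell k}>0$. Shunt admittances are zero. Each bus $k$ has real and reactive demands $p^D_k,q^D_k\in\mathbb R$, voltage limits $\underline v_k,\overline v_k$, generation limits $\underline p_k,\overline p_k,\underline q_k,\overline q_k$ and a convex dispatch cost $c_k:\mathbb R^2\to\mathbb R$. Let $\Phi_{k\ell},\Psi_{k\ell}$ be the Hermitian matrices of the real and reactive flow from $k$ to $\ell$: all entries are zero except $$[\Phi_{k\ell}]_{kk}=\tfrac12(y_{k\ell}+\overline{y_{k\ell}}),\quad [\Phi_{k\ell}]_{k\ell}=\overline{[\Phi_{k\ell}]_{\ell k}}=-\tfrac12 y_{k\ell},\quad [\Psi_{k\ell}]_{kk}=\tfrac1{2\mathbf i}(\overline{y_{k\ell}}-y_{k\ell}),\quad [\Psi_{k\ell}]_{k\ell}=\overline{[\Psi_{k\ell}]_{\ell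 k}}=\tfrac1{2\mathbf i}y_{k\ell}.$$ Put $\Phi_k=\sum_{\ell\sim k}\Phi_{k\ell}$ and $\Psi_k=\sum_{\ell\sim k}\Psi_{k\ell}$. **SDP-LMPs.** The problem $\mathcal P_{\sf SDP}$ is to minimize $\sum_k c_k(p^G_k,q^G_k)$ over $p^G,q^G\in\mathbb R^n$ and Hermitian $W\in\mathbb C^{n\times n}$ subject to $$\underline p_k\le p^G_k\le\overline p_k,\quad \underline q_k\le q^G_k\le\overline q_k,\quad p^G_k-p^D_k=\mathrm{Tr}(\Phi_kW),\quad q^G_k-q^D_k=\mathrm{Tr}(\Psi_kW),$$ $$\mathrm{Tr}(\Phi_{k\ell}W)\le f_{k\ell},\qquad \underline v_k^2\le W_{kk}\le\overline v_k^2\qquad (\text{all } k \text{ and all } \ell\sim k),\qquad W\succeq0.$$ The SDP-LMPs are the pairs $(\lambda^p,\lambda^q)$ of multipliers of the real and reactive power balance equations (the two equations above) that, together with some feasible point and some multipliers of the other constraints, satisfy the KKT conditions of $\mathcal P_{\sf SDP}$: primal and dual feasibility, stationarity and complementary slackness. Where $c_k$ is not differentiable, its gradient is replaced by a subgradient. **SOCP-DLMPs.**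 Choose one direction for each line, arbitrarily; $k\to\ell$ denotes a directed line. The problem $\mathcal P_{\sf SOCP}$ is to minimize $\sum_k c_k(p^G_k,q^G_k)$ over real vectors $p^G,q^G,w$ (indexed by buses) and $P,Q,J$ (indexed by directed lines) subject to $$p^G_k-p^D_k=\sum_{\ell:\,k\to\ell}P_{k\ell}-\sum_{\ell:\,\ell\to k}\bigl(P_{\ell k}-r_{\ell k}J_{\ell k}\bigr),\qquad q^G_k-q^D_k=\sum_{\ell:\,k\to\ell}Q_{k\ell}-\sum_{\ell:\,\ell\to k}\bigl(Q_{\ell k}-x_{\ell k}J_{\ell k}\bigr),$$ $$\underline p_k\le p^G_k\le\overline p_k,\quad \underline q_k\le q^G_k\le\overline q_k,\quad \underline v_k^2\le w_k\le\overline v_k^2$$ for every bus $k$, and, for every directed line $k\to\ell$, $$P_{k\ell}\le f_{k\ell},\quad r_{k\ell}J_{k\ell}-P_{k\ell}\le f_{k\ell},\quad w_\ell=w_k-2(P_{k\ell}r_{k\ell}+Q_{k\ell}x_{k\ell})+(r_{k\ell}^2+x_{k\ell}^2)J_{k\ell},\quad P_{k\ell}^2+Q_{k\ell}^2\le J_{k\ell}w_k.$$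 The last constraint is a second-order cone constraint on $(P_{k\ell},Q_{k\ell},J_{k\ell},w_k)$, and its multiplier lies in the dual of the cone $\{(P,Q,J,w): J,w\ge0,\ P^2+Q^2\le Jw\}$. The SOCP-DLMPs are the pairs $(\rho^p,\rho^q)$ of multipliers of the two power balance equations that belong to an optimal system of Lagrange multipliers of $\mathcal P_{\sf SOCP}$. That is, some feasible point and some multipliers of the other constraints satisfy, together with them, dual feasibility and complementary slackness, and the point minimizes the resulting Lagrangian over all values of the variables. In both problems the sign of the balance multipliers is such that the term $-\lambda^p_k\,(p^G_k-p^D_k-\cdots)$, and likewise for $\lambda^q$, $\rho^p$, $\rho^q$, appears in the Lagrangian of the minimization. **Theorem.** If the network is radial (its graph has no cycle), then every SDP-LMP is an SOCP-DLMP and vice versa: for every choice of the directions of the lines, the set of SDP-LMPs $(\lambda^p,\lambda^q)$ equals the set of SOCP-DLMPs $(\rho^p,\rho^q)$. -/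

import Mathlib

open scoped Matrix ComplexOrder

noncomputable section

/-- Data of the economic dispatch problem on a power network with `n` buses.
`y k l` (for `k` adjacent to `l`) is the series admittance of the line joining `k` and `l`, and
`y k k` is the shunt admittance at bus `k`; values of `y` and `f` at pairs of distinct
non-adjacent buses are never used. -/
structure PowerNetwork (n : ℕ) where
  /-- the lines: `graph.Adj k l` means that a transmission line connects buses `k` and `l` -/
  graph : SimpleGraph (Fin n)
  /-- line admittances (off the diagonal) and shunt admittances (on the diagonal) -/
  y : Fin n → Fin n → ℂ
  y_symm : ∀ k l, graph.Adj k l → y k l = y l k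
  y_ne_zero : ∀ k l, graph.Adj k l → y k l ≠ 0
  /-- real power flow limit of each line, the same in both directions -/
  f : Fin n → Fin n → ℝ
  f_symm : ∀ k l, graph.Adj k l → f k l = f l k
  f_pos : ∀ k l, graph.Adj k l → 0 < f k l
  /-- lower voltage magnitude limits -/
  vmin : Fin n → ℝ
  /-- upper voltage magnitude limits -/
  vmax : Fin n → ℝ
  /-- nominal real power demands -/
  pD : Fin n → ℝ
  /-- nominal reactive power demands -/
  qD : Fin n → ℝ
  pmin : Fin n → ℝ
  pmax : Fin n → ℝ
  qmin : Fin n → ℝ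
  qmax : Fin n → ℝ
  /-- dispatch costs `c k (p, q)` -/
  c : Fin n → ℝ × ℝ → ℝ
  c_convex : ∀ k, ConvexOn ℝ Set.univ (c k)

namespace PowerNetwork

variable {n : ℕ}

/-! ### The semidefinite relaxation -/

/-- Hermitian matrix of the real power flow from `k` to `l` (for `k ≠ l`). -/
def Phi (N : PowerNetwork n) (k l : Fin n) : Matrix (Fin n) (Fin n) ℂ :=
  Matrix.single k k (1 / 2 * (N.y k l + star (N.y k l)))
    + Matrix.single k l (-(1 / 2) * N.y k l)
    + Matrix.single l k (star (-(1 / 2) * N.y k l))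

/-- Hermitian matrix of the reactive power flow from `k` to `l` (for `k ≠ l`). -/
def Psi (N : PowerNetwork n) (k l : Fin n) : Matrix (Fin n) (Fin n) ℂ :=
  Matrix.single k k (1 / (2 * Complex.I) * (star (N.y k l) - N.y k l))
    + Matrix.single k l (1 / (2 * Complex.I) * N.y k l)
    + Matrix.single l k (star (1 / (2 * Complex.I) * N.y k l))

open Classical in
/-- Hermitian matrix of the real power injection at bus `k`. -/
def PhiBus (N : PowerNetwork n) (k : Fin n) : Matrix (Fin n) (Fin n) ℂ :=
  Matrix.single k k (1 / 2 * (N.y k k + star (N.y k k)))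
    + ∑ l with N.graph.Adj k l, N.Phi k l

open Classical in
/-- Hermitian matrix of the reactive power injection at bus `k`. -/
def PsiBus (N : PowerNetwork n) (k : Fin n) : Matrix (Fin n) (Fin n) ℂ :=
  Matrix.single k k (1 / (2 * Complex.I) * (star (N.y k k) - N.y k k))
    + ∑ l with N.graph.Adj k l, N.Psi k l

/-- `Tr (M W)`; it is a real number when `M` and `W` are Hermitian. -/
def tr (M W : Matrix (Fin n) (Fin n) ℂ) : ℝ := (M * W).trace.re

/-- Feasible points `(W, pG, qG)` of the semidefinite relaxation. -/
structure SDPFeasible (N : PowerNetwork n) (W : Matrix (Fin n) (Fin n) ℂ)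
    (pG qG : Fin n → ℝ) : Prop where
  p_bounds : ∀ k, N.pmin k ≤ pG k ∧ pG k ≤ N.pmax k
  q_bounds : ∀ k, N.qmin k ≤ qG k ∧ qG k ≤ N.qmax k
  p_balance : ∀ k, pG k - N.pD k = tr (N.PhiBus k) W
  q_balance : ∀ k, qG k - N.qD k = tr (N.PsiBus k) W
  flow : ∀ k l, N.graph.Adj k l → tr (N.Phi k l) W ≤ N.f k l
  voltage : ∀ k, N.vmin k ^ 2 ≤ tr (Matrix.single k k 1) W ∧
    tr (Matrix.single k k 1) W ≤ N.vmax k ^ 2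
  psd : W.PosSemidef

/-- Lagrange multipliers of the semidefinite relaxation. -/
structure SDPMult (n : ℕ) where
  /-- real power balance -/
  lamP : Fin n → ℝ
  /-- reactive power balance -/
  lamQ : Fin n → ℝ
  /-- upper and lower bounds on real and on reactive generation -/
  pU : Fin n → ℝ
  pL : Fin n → ℝ
  qU : Fin n → ℝ
  qL : Fin n → ℝ
  /-- line flow limits, one for each direction of each line -/
  mu : Fin n → Fin n → ℝ
  /-- upper and lower voltage limits -/
  vU : Fin n → ℝ
  vL : Fin n → ℝ
  /-- the constraint that `W` is positive semidefinite -/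
  U : Matrix (Fin n) (Fin n) ℂ

open Classical in
/-- The KKT conditions of the semidefinite relaxation. -/
structure SDPKKT (N : PowerNetwork n) (W : Matrix (Fin n) (Fin n) ℂ) (pG qG : Fin n → ℝ)
    (m : SDPMult n) : Prop where
  primal : N.SDPFeasible W pG qG
  gen_nonneg : ∀ k, 0 ≤ m.pU k ∧ 0 ≤ m.pL k ∧ 0 ≤ m.qU k ∧ 0 ≤ m.qL k
  mu_nonneg : ∀ k l, N.graph.Adj k l → 0 ≤ m.mu k l
  v_nonneg : ∀ k, 0 ≤ m.vU k ∧ 0 ≤ m.vL k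
  U_psd : m.U.PosSemidef
  /-- stationarity in `W` -/
  stat_W : ∑ k, (m.lamP k : ℂ) • N.PhiBus k + ∑ k, (m.lamQ k : ℂ) • N.PsiBus k
    + ∑ k, ∑ l with N.graph.Adj k l, (m.mu k l : ℂ) • N.Phi k l
    + ∑ k, (m.vU k : ℂ) • Matrix.single k k 1
    - ∑ k, (m.vL k : ℂ) • Matrix.single k k 1 - m.U = 0
  /-- stationarity in the generation at bus `k`: the vector
  `(lamP k - pU k + pL k, lamQ k - qU k + qL k)` is a subgradient of the convex function `c k`
  at `(pG k, qG k)` (so it is the gradient, where `c k` is differentiable) -/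
  stat_gen : ∀ k p q, N.c k (pG k, qG k) + (m.lamP k - m.pU k + m.pL k) * (p - pG k)
    + (m.lamQ k - m.qU k + m.qL k) * (q - qG k) ≤ N.c k (p, q)
  cs_flow : ∀ k l, N.graph.Adj k l → m.mu k l * (tr (N.Phi k l) W - N.f k l) = 0
  cs_vU : ∀ k, m.vU k * (tr (Matrix.single k k 1) W - N.vmax k ^ 2) = 0
  cs_vL : ∀ k, m.vL k * (tr (Matrix.single k k 1) W - N.vmin k ^ 2) = 0
  cs_qL : ∀ k, m.qL k * (qG k - N.qmin k) = 0
  cs_qU : ∀ k, m.qU k * (qG k - N.qmax k) = 0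
  cs_pL : ∀ k, m.pL k * (pG k - N.pmin k) = 0
  cs_pU : ∀ k, m.pU k * (pG k - N.pmax k) = 0
  cs_psd : tr m.U W = 0

/-- The set of SDP-LMPs `(lamP, lamQ)`. -/
def sdpLMPs (N : PowerNetwork n) : Set ((Fin n → ℝ) × (Fin n → ℝ)) :=
  {lam | ∃ W pG qG m, N.SDPKKT W pG qG m ∧ lam = (m.lamP, m.lamQ)}

/-! ### The second-order cone relaxation of the branch flow model -/

/-- `dir k l` (read `k → l`) chooses exactly one direction for each line of the network. -/
def IsOrientation (N : PowerNetwork n) (dir : Fin n → Fin n → Prop) : Prop :=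
  (∀ k l, dir k l → N.graph.Adj k l) ∧ ∀ k l, N.graph.Adj k l → Xor (dir k l) (dir l k)

/-- line resistance -/
def r (N : PowerNetwork n) (k l : Fin n) : ℝ := (1 / N.y k l).re

/-- line reactance -/
def x (N : PowerNetwork n) (k l : Fin n) : ℝ := (1 / N.y k l).im

/-- Variables of the second-order cone relaxation. Only the values of `P`, `Q`, `J` at directed
edges are ever used. -/
structure SOCPVar (n : ℕ) where
  pG : Fin n → ℝ
  qG : Fin n → ℝ
  w : Fin n → ℝ
  P : Fin n → Fin n → ℝ
  Q : Fin n → Fin n → ℝ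
  J : Fin n → Fin n → ℝ

open Classical in
/-- Real power leaving bus `k` into the network, in terms of the branch flow variables. -/
def injP (N : PowerNetwork n) (dir : Fin n → Fin n → Prop) (z : SOCPVar n) (k : Fin n) : ℝ :=
  ∑ l with dir k l, z.P k l - ∑ l with dir l k, (z.P l k - N.r l k * z.J l k)

open Classical in
/-- Reactive power leaving bus `k` into the network, in terms of the branch flow variables. -/
def injQ (N : PowerNetwork n) (dir : Fin n → Fin n → Prop) (z : SOCPVar n) (k : Fin n) : ℝ :=
  ∑ l with dir k l, z.Q k l - ∑ l with dir l k, (z.Q l k - N.x l k * z.J l k)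

/-- Feasible points of the second-order cone relaxation. -/
structure SOCPFeasible (N : PowerNetwork n) (dir : Fin n → Fin n → Prop) (z : SOCPVar n) :
    Prop where
  p_balance : ∀ k, z.pG k - N.pD k = N.injP dir z k
  q_balance : ∀ k, z.qG k - N.qD k = N.injQ dir z k
  flow : ∀ k l, dir k l → z.P k l ≤ N.f k l
  flow_rev : ∀ k l, dir k l → N.r k l * z.J k l - z.P k l ≤ N.f k l
  p_bounds : ∀ k, N.pmin k ≤ z.pG k ∧ z.pG k ≤ N.pmax k
  q_bounds : ∀ k, N.qmin k ≤ z.qG k ∧ z.qG k ≤ N.qmax k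
  voltage : ∀ k, N.vmin k ^ 2 ≤ z.w k ∧ z.w k ≤ N.vmax k ^ 2
  drop : ∀ k l, dir k l → z.w l = z.w k - 2 * (z.P k l * N.r k l + z.Q k l * N.x k l)
    + (N.r k l ^ 2 + N.x k l ^ 2) * z.J k l
  soc : ∀ k l, dir k l → z.P k l ^ 2 + z.Q k l ^ 2 ≤ z.J k l * z.w k

/-- `(a, b, s, t)` lies in the dual of the (rotated) second-order cone
`{(P, Q, J, w) | 0 ≤ J, 0 ≤ w, P² + Q² ≤ J w}`. -/
def InDualSOC (a b s t : ℝ) : Prop :=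
  ∀ P Q J w : ℝ, 0 ≤ J → 0 ≤ w → P ^ 2 + Q ^ 2 ≤ J * w → 0 ≤ a * P + b * Q + s * J + t * w

/-- Lagrange multipliers of the second-order cone relaxation. -/
structure SOCPMult (n : ℕ) where
  /-- real power balance -/
  rhoP : Fin n → ℝ
  /-- reactive power balance -/
  rhoQ : Fin n → ℝ
  /-- upper and lower bounds on real and on reactive generation -/
  pU : Fin n → ℝ
  pL : Fin n → ℝ
  qU : Fin n → ℝ
  qL : Fin n → ℝ
  /-- upper and lower voltage limits -/
  vU : Fin n → ℝ
  vL : Fin n → ℝ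
  /-- flow limits at the sending and at the receiving end of each directed edge -/
  mu : Fin n → Fin n → ℝ
  muRev : Fin n → Fin n → ℝ
  /-- the voltage drop equation of each directed edge -/
  beta : Fin n → Fin n → ℝ
  /-- the second-order cone constraint on `(P, Q, J, w)` of each directed edge -/
  sP : Fin n → Fin n → ℝ
  sQ : Fin n → Fin n → ℝ
  sJ : Fin n → Fin n → ℝ
  sw : Fin n → Fin n → ℝ

open Classical in
/-- The Lagrangian of the second-order cone relaxation. -/
def socpLagrangian (N : PowerNetwork n) (dir : Fin n → Fin n → Prop) (z : SOCPVar n)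
    (m : SOCPMult n) : ℝ :=
  ∑ k, N.c k (z.pG k, z.qG k)
    - ∑ k, m.rhoP k * (z.pG k - N.pD k - N.injP dir z k)
    - ∑ k, m.rhoQ k * (z.qG k - N.qD k - N.injQ dir z k)
    + ∑ k, (m.pU k * (z.pG k - N.pmax k) - m.pL k * (z.pG k - N.pmin k))
    + ∑ k, (m.qU k * (z.qG k - N.qmax k) - m.qL k * (z.qG k - N.qmin k))
    + ∑ k, (m.vU k * (z.w k - N.vmax k ^ 2) - m.vL k * (z.w k - N.vmin k ^ 2))
    + ∑ k, ∑ l with dir k l,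
        (m.mu k l * (z.P k l - N.f k l)
          + m.muRev k l * (N.r k l * z.J k l - z.P k l - N.f k l)
          + m.beta k l * (z.w l - (z.w k - 2 * (z.P k l * N.r k l + z.Q k l * N.x k l)
              + (N.r k l ^ 2 + N.x k l ^ 2) * z.J k l))
          - (m.sP k l * z.P k l + m.sQ k l * z.Q k l + m.sJ k l * z.J k l + m.sw k l * z.w k))

/-- The multipliers `m` are optimal, with `z` an optimal primal point: primal and dual
feasibility, minimality of the Lagrangian at `z` over all values of the variables, and
complementary slackness. -/
structure SOCPOptimal (N : PowerNetwork n) (dir : Fin n → Fin n → Prop) (z : SOCPVar n)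
    (m : SOCPMult n) : Prop where
  primal : N.SOCPFeasible dir z
  gen_nonneg : ∀ k, 0 ≤ m.pU k ∧ 0 ≤ m.pL k ∧ 0 ≤ m.qU k ∧ 0 ≤ m.qL k
  v_nonneg : ∀ k, 0 ≤ m.vU k ∧ 0 ≤ m.vL k
  mu_nonneg : ∀ k l, dir k l → 0 ≤ m.mu k l ∧ 0 ≤ m.muRev k l
  s_dual : ∀ k l, dir k l → InDualSOC (m.sP k l) (m.sQ k l) (m.sJ k l) (m.sw k l)
  stationary : ∀ z' : SOCPVar n, N.socpLagrangian dir z m ≤ N.socpLagrangian dir z' m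
  cs_flow : ∀ k l, dir k l → m.mu k l * (z.P k l - N.f k l) = 0
  cs_flow_rev : ∀ k l, dir k l → m.muRev k l * (N.r k l * z.J k l - z.P k l - N.f k l) = 0
  cs_vU : ∀ k, m.vU k * (z.w k - N.vmax k ^ 2) = 0
  cs_vL : ∀ k, m.vL k * (z.w k - N.vmin k ^ 2) = 0
  cs_qL : ∀ k, m.qL k * (z.qG k - N.qmin k) = 0
  cs_qU : ∀ k, m.qU k * (z.qG k - N.qmax k) = 0
  cs_pL : ∀ k, m.pL k * (z.pG k - N.pmin k) = 0
  cs_pU : ∀ k, m.pU k * (z.pG k - N.pmax k) = 0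
  cs_soc : ∀ k l, dir k l →
    m.sP k l * z.P k l + m.sQ k l * z.Q k l + m.sJ k l * z.J k l + m.sw k l * z.w k = 0

/-- The set of SOCP-DLMPs `(rhoP, rhoQ)`. -/
def socpDLMPs (N : PowerNetwork n) (dir : Fin n → Fin n → Prop) :
    Set ((Fin n → ℝ) × (Fin n → ℝ)) :=
  {rho | ∃ z m, N.SOCPOptimal dir z m ∧ rho = (m.rhoP, m.rhoQ)}

end PowerNetwork

end

/-! On a line, `P + iQ = conj(y) (W_kk - W_kl)`. Hence branch flow variables satisfying the voltage
drop equations correspond linearly and bijectively to the diagonal and line entries of a Hermitian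
`W`, which are the only entries that the data of the SDP see. Under this correspondence the cone
constraint of a line says that a `2 × 2` minor of `W` is nonnegative.

On a forest this local condition is dual to itself. Primal side: nonnegative diagonal entries and
line minors suffice for a positive semidefinite completion (`Matrix.exists_posSemidef_completion`).
Dual side: a positive semidefinite matrix with forest pattern is a sum of positive semidefinite edge
blocks and a nonnegative diagonal (`Matrix.PosSemidef.exists_edge_decomposition`). Both follow by
removing one vertex with at most one neighbour at a time.

An SDP multiplier `U` splits into edge blocks, which become cone multipliers, and a diagonal, which
joins the multipliers of the lower voltage limits. Conversely, SOCP multipliers define `U` by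
stationarity, and evaluation at rank one matrices shows that it is positive semidefinite. The
balance multipliers are unchanged both ways. -/

/-- Every nonempty finite set of vertices of a forest contains a vertex that has at most one
neighbour in the set. -/
theorem SimpleGraph.IsAcyclic.exists_mem_forall_adj_eq {V : Type*} {G : SimpleGraph V}
    (hG : G.IsAcyclic) {S : Finset V} (hS : S.Nonempty) :
    ∃ l ∈ S, ∃ k, ∀ j ∈ S, G.Adj l j → j = k := by
  classical
  have : Nonempty (S : Set V) := hS.to_subtype
  -- The end `v` of a longest path has no neighbour off the path, and in a forest only the
  -- penultimate vertex can be its neighbour on the path.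
  obtain ⟨u, v, p, hp, hmax⟩ :=
    SimpleGraph.Walk.exists_isPath_forall_isPath_length_le_length (G.induce (S : Set V))
  refine ⟨v, v.2, p.penultimate, fun j hjS hj => ?_⟩
  have hadj : (G.induce (S : Set V)).Adj v ⟨j, hjS⟩ := hj
  have hmem : (⟨j, hjS⟩ : (S : Set V)) ∈ p.support := by
    by_contra hjs
    have := hmax _ _ (p.concat hadj) (hp.concat hjs hadj)
    rw [SimpleGraph.Walk.length_concat] at this
    omega
  exact congrArg Subtype.val ((hG.induce (S : Set V)).eq_penultimate_of_adj_end hp hadj hmem)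

/-! ### Positive semidefinite matrices and forests -/

namespace Matrix

variable {ι : Type*} [Fintype ι] [DecidableEq ι]

theorem IsHermitian.im_diag_eq_zero {ι : Type*} {W : Matrix ι ι ℂ} (hW : W.IsHermitian) (k : ι) :
    (W k k).im = 0 :=
  Complex.conj_eq_iff_im.1 (hW.apply k k)

theorem PosSemidef.re_diag_nonneg {ι : Type*} {W : Matrix ι ι ℂ} (hW : W.PosSemidef) (k : ι) :
    0 ≤ (W k k).re :=
  (Complex.nonneg_iff.1 hW.diag_nonneg).1

/-- This is the sign of a `2 × 2` minor; `submatrix` needs no injectivity, so `i = j` is allowed. -/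
theorem PosSemidef.normSq_le {ι : Type*} {W : Matrix ι ι ℂ} (hW : W.PosSemidef) (i j : ι) :
    Complex.normSq (W i j) ≤ (W i i).re * (W j j).re := by
  have h := (Complex.nonneg_iff.1 (hW.submatrix ![i, j]).det_nonneg).1
  have hij : W j i = star (W i j) := (hW.1.apply j i).symm
  simp only [det_fin_two, submatrix_apply, cons_val_zero, cons_val_one, hij, Complex.sub_re,
    Complex.mul_re, hW.1.im_diag_eq_zero, Complex.star_def, Complex.conj_re, Complex.conj_im] at h
  rw [Complex.normSq_apply]
  linarith

/-- The Schur complement of a diagonal entry of a positive semidefinite matrix. -/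
theorem PosSemidef.schur_diag {U : Matrix ι ι ℂ} (hU : U.PosSemidef) (l : ι) (hl : U l l ≠ 0) :
    (of fun i j => U i j - U i l * U l j / U l l : Matrix ι ι ℂ).PosSemidef := by
  -- Column operations that clear row `l`. `U * B` is already the Schur complement; its row `l` is
  -- zero, so the factor `Bᴴ` changes nothing and only makes the operation a congruence.
  set B : Matrix ι ι ℂ := 1 - vecMulVec (Pi.single l 1) (fun j => U l j / U l l) with hB
  have hUB : U * B = of fun i j => U i j - U i l * U l j / U l l := by
    rw [hB, mul_sub, mul_one, mul_vecMulVec]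
    ext i j
    simp [vecMulVec_apply, mul_div_assoc]
  have h : Bᴴ * U * B = of fun i j => U i j - U i l * U l j / U l l := by
    rw [mul_assoc, hUB, hB, conjTranspose_sub, sub_mul, conjTranspose_one, one_mul,
      conjTranspose_vecMulVec, vecMulVec_mul]
    ext i j
    simp [vecMulVec_apply, single_vecMul, hl]
  exact h ▸ hU.conjTranspose_mul_mul_same B

/-- Positive semidefinite completion of a partial Hermitian matrix whose pattern is a forest. -/
theorem exists_posSemidef_completion {G : SimpleGraph ι} (hG : G.IsAcyclic) (w : ι → ℝ)
    (hw : ∀ k, 0 ≤ w k) (c : ι → ι → ℂ) (hc : ∀ k l, G.Adj k l → c l k = star (c k l))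
    (hcw : ∀ k l, G.Adj k l → Complex.normSq (c k l) ≤ w k * w l) :
    ∃ W : Matrix ι ι ℂ, W.PosSemidef ∧ (∀ k, W k k = w k) ∧ ∀ k l, G.Adj k l → W k l = c k l := by
  suffices H : ∀ S : Finset ι, ∃ W : Matrix ι ι ℂ, W.PosSemidef ∧ (∀ k ∈ S, W k k = w k) ∧
      ∀ k ∈ S, ∀ l ∈ S, G.Adj k l → W k l = c k l by
    simpa using H Finset.univ
  intro S
  induction S using Finset.strongInduction with
  | H S ih =>
    rcases S.eq_empty_or_nonempty with rfl | hS
    · exact ⟨0, PosSemidef.zero, by simp, by simp⟩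
    obtain ⟨l, hlS, k, hk⟩ := hG.exists_mem_forall_adj_eq hS
    obtain ⟨W, hW, hWd, hWe⟩ := ih (S.erase l) (Finset.erase_ssubset hlS)
    by_cases hadj : k ∈ S ∧ G.Adj l k
    · obtain ⟨hkS, hlk⟩ := hadj
      have hkl : k ≠ l := hlk.ne'
      have hWk : W k k = w k := hWd k (by simp [hkS, hkl])
      -- Row and column `l` become `α` times those of `k`, which puts `α * w k = c l k` at `(l, k)`;
      -- `D` then raises the diagonal entry from `|α|² w k` to `w l`. If `w k = 0`, then `α = 0` by
      -- convention, and `c l k = 0` by `hcw`.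
      set α : ℂ := c l k / w k with hα
      have hcα : α * w k = c l k := by
        rcases eq_or_ne (w k) 0 with h0 | h0
        · have := hcw l k hlk
          rw [h0, mul_zero] at this
          have h1 := Complex.normSq_eq_zero.1 (le_antisymm this (Complex.normSq_nonneg _))
          simp [h0, h1]
        · rw [hα, div_mul_cancel₀]
          exact_mod_cast h0
      have hd : 0 ≤ w l - Complex.normSq α * w k := by
        rcases eq_or_ne (w k) 0 with h0 | h0
        · simpa [h0] using hw l
        · have h1 := hcw l k hlk
          rw [← hcα, Complex.normSq_mul, Complex.normSq_ofReal] at h1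
          have h2 : 0 < w k := lt_of_le_of_ne (hw k) (Ne.symm h0)
          rw [sub_nonneg]
          refine le_of_mul_le_mul_right ?_ h2
          linarith
      set σ : ι → ι := fun i => if i = l then k else i with hσ
      set a : ι → ℂ := fun i => if i = l then α else 1 with ha
      set D : ι → ℂ := fun i => if i = l then ((w l - Complex.normSq α * w k : ℝ) : ℂ) else 0
        with hD
      have hent : ∀ i j, (diagonal a * W.submatrix σ σ * (diagonal a)ᴴ + diagonal D) i j
          = a i * W (σ i) (σ j) * star (a j) + diagonal D i j := by
        intro i j
        simp [diagonal_conjTranspose, mul_diagonal, diagonal_mul]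
      refine ⟨diagonal a * W.submatrix σ σ * (diagonal a)ᴴ + diagonal D, ?_, ?_, ?_⟩
      · refine ((hW.submatrix σ).mul_mul_conjTranspose_same _).add (PosSemidef.diagonal ?_)
        intro i
        by_cases hi : i = l
        · simp only [hD, hi, if_true, Pi.zero_apply]
          exact_mod_cast hd
        · simp [hD, hi]
      · intro i hi
        rw [hent]
        by_cases hil : i = l
        · subst hil
          simp only [hσ, ha, hD, if_true, hWk, diagonal_apply_eq, Complex.star_def]
          have := Complex.mul_conj α
          push_cast
          linear_combination (w k : ℂ) * this
        · simp [hσ, ha, hD, hil, hWd i (by simp [hi, hil])]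
      · intro i hi j hj hij
        rw [hent, diagonal_apply_ne _ hij.ne, add_zero]
        by_cases hil : i = l
        · subst hil
          obtain rfl := hk j hj hij
          simp [hσ, ha, hkl, hWk, hcα]
        · by_cases hjl : j = l
          · subst hjl
            obtain rfl := hk i hi hij.symm
            rw [hc j i hij.symm, ← hcα]
            simp [hσ, ha, hkl, hWk, mul_comm]
          · simp [hσ, ha, hil, hjl, hWe i (by simp [hi, hil]) j (by simp [hj, hjl]) hij]
    · have hno : ∀ j ∈ S, ¬ G.Adj l j := fun j hj hlj => hadj (hk j hj hlj ▸ ⟨hj, hlj⟩)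
      set a : ι → ℂ := fun i => if i = l then 0 else 1 with ha
      set D : ι → ℂ := fun i => if i = l then (w l : ℂ) else 0 with hD
      have hent : ∀ i j, (diagonal a * W * (diagonal a)ᴴ + diagonal D) i j
          = a i * W i j * star (a j) + diagonal D i j := by
        intro i j
        simp [diagonal_conjTranspose, mul_diagonal, diagonal_mul]
      refine ⟨diagonal a * W * (diagonal a)ᴴ + diagonal D, ?_, ?_, ?_⟩
      · refine (hW.mul_mul_conjTranspose_same _).add (PosSemidef.diagonal ?_)
        intro i
        by_cases hi : i = l
        · simp only [hD, hi, if_true, Pi.zero_apply]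
          exact_mod_cast hw l
        · simp [hD, hi]
      · intro i hi
        rw [hent]
        by_cases hil : i = l
        · simp [ha, hD, hil]
        · simp [ha, hD, hil, hWd i (by simp [hi, hil])]
      · intro i hi j hj hij
        have hil : i ≠ l := fun h => hno j hj (h ▸ hij)
        have hjl : j ≠ l := fun h => hno i hi (h ▸ hij.symm)
        rw [hent, diagonal_apply_ne _ hij.ne]
        simp [ha, hil, hjl, hWe i (by simp [hi, hil]) j (by simp [hj, hjl]) hij]

open Classical in
/-- A positive semidefinite matrix whose pattern is a forest is the sum of positive semidefinite
matrices supported on single edges and of a nonnegative diagonal matrix; `a k l` is the `(k, k)`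
entry of the summand of the edge `{k, l}`. -/
theorem PosSemidef.exists_edge_decomposition {G : SimpleGraph ι} (hG : G.IsAcyclic)
    {U : Matrix ι ι ℂ} (hU : U.PosSemidef) (hUG : ∀ i j, i ≠ j → ¬ G.Adj i j → U i j = 0) :
    ∃ a : ι → ι → ℝ, (∀ k l, 0 ≤ a k l) ∧
      (∀ k l, G.Adj k l → Complex.normSq (U k l) ≤ a k l * a l k) ∧
      ∀ k, ∑ l with G.Adj k l, a k l ≤ (U k k).re := by
  -- The matrix varies in the induction, since removing a leaf replaces it by a Schur complement;
  -- `S` bounds its off-diagonal support.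
  suffices H : ∀ S : Finset ι, ∀ U : Matrix ι ι ℂ, U.PosSemidef →
      (∀ i j, i ≠ j → U i j ≠ 0 → i ∈ S ∧ j ∈ S ∧ G.Adj i j) →
      ∃ a : ι → ι → ℝ, (∀ k l, 0 ≤ a k l) ∧
        (∀ k l, G.Adj k l → Complex.normSq (U k l) ≤ a k l * a l k) ∧
        ∀ k, ∑ l with G.Adj k l, a k l ≤ (U k k).re by
    refine H Finset.univ U hU fun i j hij h => ⟨by simp, by simp, ?_⟩
    by_contra hn
    exact h (hUG i j hij hn)
  intro S
  induction S using Finset.strongInduction with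
  | H S ih =>
    intro U hU hUS
    rcases S.eq_empty_or_nonempty with rfl | hS
    · refine ⟨fun _ _ => 0, by simp, fun k l hkl => ?_, fun k => by simpa using hU.re_diag_nonneg k⟩
      have : U k l = 0 := by
        by_contra h
        simpa using (hUS k l hkl.ne h).1
      simp [this]
    obtain ⟨l, hlS, k, hk⟩ := hG.exists_mem_forall_adj_eq hS
    have hrow : ∀ j, j ≠ l → U l j ≠ 0 → j = k := fun j hj h =>
      hk j (hUS l j hj.symm h).2.1 (hUS l j hj.symm h).2.2
    by_cases hz : ∀ j, j ≠ l → U l j = 0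
    · refine ih (S.erase l) (Finset.erase_ssubset hlS) U hU fun i j hij h => ?_
      obtain ⟨hi, hj, ha⟩ := hUS i j hij h
      have hil : i ≠ l := by
        rintro rfl
        exact h (hz j hij.symm)
      have hjl : j ≠ l := by
        rintro rfl
        apply h
        rw [← hU.1.apply, hz i hij, star_zero]
      exact ⟨by simp [hi, hil], by simp [hj, hjl], ha⟩
    · push Not at hz
      obtain ⟨j, hjl, hj⟩ := hz
      obtain rfl := hrow j hjl hj
      rename' j => k, hjl => hkl, hj => hlk
      have hadj : G.Adj l k := (hUS l k hkl.symm hlk).2.2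
      have hpos : 0 < (U l l).re := by
        have h1 := hU.normSq_le l k
        have h2 := Complex.normSq_pos.2 hlk
        have h3 := hU.re_diag_nonneg l
        rcases h3.eq_or_lt with h | h
        · rw [← h, zero_mul] at h1
          linarith
        · exact h
      have hll : U l l = ((U l l).re : ℂ) := by
        apply Complex.ext <;> simp [hU.1.im_diag_eq_zero]
      have hne : U l l ≠ 0 := by
        intro h
        simp [h] at hpos
      have hcol : ∀ i, i ≠ l → i ≠ k → U i l = 0 := by
        intro i hil hik
        by_contra h
        refine hik (hrow i hil fun h' => h ?_)
        rw [← hU.1.apply, h', star_zero]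
      -- Outside row and column `l`, eliminating `l` alters only the entry `(k, k)`, because `k` is
      -- the only index coupled to `l`. No fill-in arises, so the forest pattern survives.
      set U' : Matrix ι ι ℂ := of fun i j => U i j - U i l * U l j / U l l with hU'
      have hU'e : ∀ i j, i ≠ l → j ≠ l → i ≠ j → U' i j = U i j := by
        intro i j hil hjl hij
        simp only [hU', of_apply]
        by_cases hik : i = k
        · have : U l j = 0 := by
            by_contra h
            exact hij (hik.trans (hrow j hjl h).symm)
          simp [this]
        · simp [hcol i hil hik]
      have hU'l : ∀ j, U' l j = 0 := by
        intro j
        simp [hU', hne]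
      have hU'r : ∀ j, U' j l = 0 := by
        intro j
        simp [hU', hne]
      obtain ⟨a, ha0, hae, had⟩ := ih (S.erase l) (Finset.erase_ssubset hlS) U'
        (hU.schur_diag l hne) (by
          intro i j hij h
          have hil : i ≠ l := by
            rintro rfl
            exact h (hU'l j)
          have hjl : j ≠ l := by
            rintro rfl
            exact h (hU'r i)
          rw [hU'e i j hil hjl hij] at h
          obtain ⟨hi, hj, ha⟩ := hUS i j hij h
          exact ⟨by simp [hi, hil], by simp [hj, hjl], ha⟩)
      -- The block of the edge `{l, k}` is the subtracted rank one matrix `U i l * U l j / U l l`,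
      -- with diagonal entries `U l l` at `l` and `|U l k|² / U l l` at `k`.
      set b : ι → ι → ℝ := fun i j =>
        if i = l then (if j = k then (U l l).re else 0)
        else if j = l then (if i = k then Complex.normSq (U l k) / (U l l).re else 0)
        else a i j with hb
      refine ⟨b, ?_, ?_, ?_⟩
      · intro i j
        simp only [hb]
        split_ifs
        · exact hpos.le
        · exact le_rfl
        · exact div_nonneg (Complex.normSq_nonneg _) hpos.le
        · exact le_rfl
        · exact ha0 i j
      · have hlj : ∀ j, G.Adj l j → Complex.normSq (U l j) ≤ b l j * b j l := by
          intro j hj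
          by_cases hjk : j = k
          · subst hjk
            simp only [hb, if_true, if_neg hkl]
            rw [mul_div_cancel₀ _ hpos.ne']
          · have : U l j = 0 := by
              by_contra h
              exact hjk (hrow j hj.ne' h)
            simp [this, hb, hjk]
        intro i j hij
        by_cases hil : i = l
        · subst hil
          exact hlj j hij
        · by_cases hjl : j = l
          · subst hjl
            rw [mul_comm, ← hU.1.apply, Complex.star_def, Complex.normSq_conj]
            exact hlj i hij.symm
          · have := hae i j hij
            rw [hU'e i j hil hjl hij.ne] at this
            simpa [hb, hil, hjl] using this
      · intro i
        by_cases hil : i = l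
        · subst hil
          simp only [hb, if_true]
          rw [Finset.sum_ite_eq']
          simp [hadj]
        · by_cases hik : i = k
          · subst hik
            have h1 := had i
            rw [← Finset.add_sum_erase _ _ (a := l) (by simpa using hadj.symm)] at h1 ⊢
            have h2 : ∑ x ∈ ({x | G.Adj i x} : Finset ι).erase l, b i x
                = ∑ x ∈ ({x | G.Adj i x} : Finset ι).erase l, a i x := by
              refine Finset.sum_congr rfl fun x hx => ?_
              simp [hb, hil, Finset.ne_of_mem_erase hx]
            have h3 : b i l = Complex.normSq (U l i) / (U l l).re := by simp [hb, hil]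
            have h4 : (U' i i).re = (U i i).re - Complex.normSq (U l i) / (U l l).re := by
              have h5 : U i l * U l i = (Complex.normSq (U l i) : ℂ) := by
                rw [← hU.1.apply i l, Complex.star_def, mul_comm, Complex.mul_conj]
              simp only [hU', of_apply]
              rw [h5, hll, ← Complex.ofReal_div, Complex.sub_re, Complex.ofReal_re,
                Complex.ofReal_re]
            rw [h2, h3]
            linarith [ha0 i l]
          · have h1 := had i
            have h2 : U' i i = U i i := by simp [hU', hcol i hil hik]
            rw [h2] at h1
            refine le_trans (Finset.sum_le_sum fun x _ => ?_) h1
            by_cases hx : x = l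
            · simpa [hb, hil, hik, hx] using ha0 i l
            · simp [hb, hil, hx]

end Matrix

/-! ### Traces of the flow matrices and line parameters -/

namespace PowerNetwork

variable {n : ℕ}

theorem tr_add (A B W : Matrix (Fin n) (Fin n) ℂ) : tr (A + B) W = tr A W + tr B W := by
  simp [tr, add_mul]

theorem tr_sub (A B W : Matrix (Fin n) (Fin n) ℂ) : tr (A - B) W = tr A W - tr B W := by
  simp [tr, sub_mul]

theorem tr_sum {ι : Type*} (s : Finset ι) (A : ι → Matrix (Fin n) (Fin n) ℂ)
    (W : Matrix (Fin n) (Fin n) ℂ) : tr (∑ i ∈ s, A i) W = ∑ i ∈ s, tr (A i) W := by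
  simp [tr, Finset.sum_mul, Matrix.trace_sum]

theorem tr_ofReal_smul (a : ℝ) (A W : Matrix (Fin n) (Fin n) ℂ) :
    tr ((a : ℂ) • A) W = a * tr A W := by
  simp [tr]

theorem tr_single (i j : Fin n) (a : ℂ) (W : Matrix (Fin n) (Fin n) ℂ) :
    tr (Matrix.single i j a) W = (a * W j i).re := by
  simp [tr, Matrix.trace_single_mul]

variable (N : PowerNetwork n)

theorem tr_Phi {W : Matrix (Fin n) (Fin n) ℂ} (hW : W.IsHermitian) (k l : Fin n) :
    tr (N.Phi k l) W = (N.y k l).re * (W k k).re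
      - ((N.y k l).re * (W k l).re + (N.y k l).im * (W k l).im) := by
  have h : W l k = star (W k l) := (hW.apply l k).symm
  simp only [Phi, tr_add, tr_single, h]
  simp [hW.im_diag_eq_zero]
  ring

theorem tr_Psi {W : Matrix (Fin n) (Fin n) ℂ} (hW : W.IsHermitian) (k l : Fin n) :
    tr (N.Psi k l) W = -(N.y k l).im * (W k k).re
      + ((N.y k l).im * (W k l).re - (N.y k l).re * (W k l).im) := by
  have h : W l k = star (W k l) := (hW.apply l k).symm
  have hI : 1 / (2 * Complex.I) = -(Complex.I / 2) := by
    rw [div_eq_iff (by simp)]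
    linear_combination Complex.I_mul_I
  simp only [Psi, tr_add, tr_single, h, hI]
  simp [hW.im_diag_eq_zero]
  ring

theorem Phi_isHermitian (k l : Fin n) : (N.Phi k l).IsHermitian := by
  simp only [Phi, Matrix.IsHermitian, Matrix.conjTranspose_add, Matrix.conjTranspose_single,
    star_star]
  rw [add_assoc, add_assoc, add_comm (Matrix.single l k _)]
  congr 2
  simp
  ring

theorem Psi_isHermitian (k l : Fin n) : (N.Psi k l).IsHermitian := by
  simp only [Psi, Matrix.IsHermitian, Matrix.conjTranspose_add, Matrix.conjTranspose_single,
    star_star]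
  rw [add_assoc, add_assoc, add_comm (Matrix.single l k _)]
  congr 2
  simp
  ring

open Classical in
theorem PhiBus_eq (hshunt : ∀ k, N.y k k = 0) (k : Fin n) :
    N.PhiBus k = ∑ l with N.graph.Adj k l, N.Phi k l := by
  simp [PhiBus, hshunt]

open Classical in
theorem PsiBus_eq (hshunt : ∀ k, N.y k k = 0) (k : Fin n) :
    N.PsiBus k = ∑ l with N.graph.Adj k l, N.Psi k l := by
  simp [PsiBus, hshunt]

/-- With `y_re` and `y_im`, this is the only relation between admittance and impedance used to pass
between `W` and the branch flow variables. -/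
theorem normSq_y_mul {k l : Fin n} (h : N.graph.Adj k l) :
    Complex.normSq (N.y k l) * (N.r k l ^ 2 + N.x k l ^ 2) = 1 := by
  have h0 := Complex.normSq_pos.2 (N.y_ne_zero k l h)
  have : N.r k l ^ 2 + N.x k l ^ 2 = Complex.normSq (1 / N.y k l) := by
    rw [Complex.normSq_apply, r, x]
    ring
  rw [this, Complex.normSq_div, map_one, mul_one_div_cancel h0.ne']

theorem sq_add_sq_pos {k l : Fin n} (h : N.graph.Adj k l) : 0 < N.r k l ^ 2 + N.x k l ^ 2 := by
  have h0 := Complex.normSq_nonneg (N.y k l)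
  have h1 := N.normSq_y_mul h
  by_contra hn
  nlinarith

theorem y_re (k l : Fin n) : (N.y k l).re = Complex.normSq (N.y k l) * N.r k l := by
  rcases eq_or_ne (N.y k l) 0 with h | h
  · simp [h]
  · have h0 := Complex.normSq_pos.2 h
    simp only [r, one_div, Complex.inv_re]
    field_simp

theorem y_im (k l : Fin n) : (N.y k l).im = -(Complex.normSq (N.y k l) * N.x k l) := by
  rcases eq_or_ne (N.y k l) 0 with h | h
  · simp [h]
  · have h0 := Complex.normSq_pos.2 h
    simp only [x, one_div, Complex.inv_im]
    field_simp

/-! ### Sums over the lines of an oriented network -/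

variable {N} {dir : Fin n → Fin n → Prop}

theorem IsOrientation.not_dir (hdir : N.IsOrientation dir) {k l : Fin n} (h : dir k l) :
    ¬ dir l k := by
  rcases hdir.2 k l (hdir.1 k l h) with h1 | h1
  · exact h1.2
  · exact absurd h h1.2

open Classical in
theorem IsOrientation.sum_adj (hdir : N.IsOrientation dir) (k : Fin n) (g : Fin n → ℝ) :
    ∑ l with N.graph.Adj k l, g l = ∑ l with dir k l, g l + ∑ l with dir l k, g l := by
  simp only [Finset.sum_filter]
  rw [← Finset.sum_add_distrib]
  refine Finset.sum_congr rfl fun l _ => ?_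
  by_cases h : dir k l
  · simp [h, hdir.1 k l h, hdir.not_dir h]
  · by_cases h' : dir l k
    · simp [h, h', (hdir.1 l k h').symm]
    · have : ¬ N.graph.Adj k l := fun ha => by
        rcases hdir.2 k l ha with h1 | h1
        · exact h h1.1
        · exact h' h1.1
      simp [h, h', this]

open Classical in
theorem sum_dir_comm (dir : Fin n → Fin n → Prop) (g : Fin n → Fin n → ℝ) :
    ∑ k, ∑ l with dir l k, g k l = ∑ k, ∑ l with dir k l, g l k := by
  simp only [Finset.sum_filter]
  rw [Finset.sum_comm]

open Classical in
theorem IsOrientation.sum_sum_adj (hdir : N.IsOrientation dir) (g : Fin n → Fin n → ℝ) :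
    ∑ k, ∑ l with N.graph.Adj k l, g k l = ∑ k, ∑ l with dir k l, (g k l + g l k) := by
  simp only [hdir.sum_adj, Finset.sum_add_distrib]
  rw [sum_dir_comm dir g]

open Classical in
-- Regrouped by lines, each line is priced by `ρ k` where power enters it and by `ρ l` where power,
-- net of losses, leaves it.
theorem sum_mul_injP (N : PowerNetwork n) (dir : Fin n → Fin n → Prop) (z : SOCPVar n)
    (ρ : Fin n → ℝ) : ∑ k, ρ k * N.injP dir z k =
      ∑ k, ∑ l with dir k l, (ρ k * z.P k l - ρ l * (z.P k l - N.r k l * z.J k l)) := by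
  simp only [injP, mul_sub, Finset.mul_sum, Finset.sum_sub_distrib]
  rw [sum_dir_comm dir (fun k l => ρ k * z.P l k),
    sum_dir_comm dir (fun k l => ρ k * (N.r l k * z.J l k))]

open Classical in
theorem sum_mul_injQ (N : PowerNetwork n) (dir : Fin n → Fin n → Prop) (z : SOCPVar n)
    (ρ : Fin n → ℝ) : ∑ k, ρ k * N.injQ dir z k =
      ∑ k, ∑ l with dir k l, (ρ k * z.Q k l - ρ l * (z.Q k l - N.x k l * z.J k l)) := by
  simp only [injQ, mul_sub, Finset.mul_sum, Finset.sum_sub_distrib]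
  rw [sum_dir_comm dir (fun k l => ρ k * z.Q l k),
    sum_dir_comm dir (fun k l => ρ k * (N.x l k * z.J l k))]

/-! ### Branch flow variables of a Hermitian matrix -/

variable (N dir) in
/-- The branch flow variables `z` are those of the Hermitian matrix `W`. -/
structure Represents (W : Matrix (Fin n) (Fin n) ℂ) (z : SOCPVar n) : Prop where
  herm : W.IsHermitian
  w : ∀ k, z.w k = (W k k).re
  P : ∀ k l, dir k l → z.P k l = tr (N.Phi k l) W
  Q : ∀ k l, dir k l → z.Q k l = tr (N.Psi k l) W
  J : ∀ k l, dir k l → z.J k l =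
    Complex.normSq (N.y k l) * ((W k k).re + (W l l).re - 2 * (W k l).re)

variable (N) in
/-- The branch flow variables of a matrix, together with given generation. -/
noncomputable def branchPoint (W : Matrix (Fin n) (Fin n) ℂ) (pG qG : Fin n → ℝ) : SOCPVar n where
  pG := pG
  qG := qG
  w k := (W k k).re
  P k l := tr (N.Phi k l) W
  Q k l := tr (N.Psi k l) W
  J k l := Complex.normSq (N.y k l) * ((W k k).re + (W l l).re - 2 * (W k l).re)

variable (dir) in
theorem represents_branchPoint {W : Matrix (Fin n) (Fin n) ℂ} (hW : W.IsHermitian)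
    (pG qG : Fin n → ℝ) : N.Represents dir W (N.branchPoint W pG qG) :=
  ⟨hW, fun _ => rfl, fun _ _ _ => rfl, fun _ _ _ => rfl, fun _ _ _ => rfl⟩

variable (N) in
/-- The voltage drop equations on the lines. -/
noncomputable def VoltageDrop (dir : Fin n → Fin n → Prop) (z : SOCPVar n) : Prop :=
  ∀ k l, dir k l → z.w l = z.w k - 2 * (z.P k l * N.r k l + z.Q k l * N.x k l)
    + (N.r k l ^ 2 + N.x k l ^ 2) * z.J k l

variable (N) in
/-- The entry at `(k, l)` of a Hermitian matrix with branch flow variables `z`. -/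
noncomputable def lineEntry (z : SOCPVar n) (k l : Fin n) : ℂ :=
  -- Solves `P + iQ = conj(y) (W_kk - W_kl)` for `W_kl = w_k - (r - ix)(P + iQ)`.
  ⟨z.w k - (z.P k l * N.r k l + z.Q k l * N.x k l), z.P k l * N.x k l - z.Q k l * N.r k l⟩

/-- With the converses `Represents.apply_eq_lineEntry` and `Represents.voltageDrop`, this identifies
solutions of the voltage drop equations with the diagonal and line entries of Hermitian matrices. -/
theorem represents_of_lineEntry (hdir : N.IsOrientation dir) {z : SOCPVar n}
    (hz : N.VoltageDrop dir z) {W : Matrix (Fin n) (Fin n) ℂ} (hW : W.IsHermitian)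
    (hd : ∀ k, W k k = z.w k) (he : ∀ k l, dir k l → W k l = N.lineEntry z k l) :
    N.Represents dir W z := by
  refine ⟨hW, fun k => by simp [hd], fun k l h => ?_, fun k l h => ?_, fun k l h => ?_⟩
  all_goals have hy := N.normSq_y_mul (hdir.1 k l h)
  · rw [N.tr_Phi hW, y_re, y_im, he k l h, hd]
    simp only [lineEntry, Complex.ofReal_re]
    linear_combination (-z.P k l) * hy
  · rw [N.tr_Psi hW, y_re, y_im, he k l h, hd]
    simp only [lineEntry, Complex.ofReal_re]
    linear_combination (-z.Q k l) * hy
  · rw [he k l h, hd, hd, hz k l h]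
    simp only [lineEntry, Complex.ofReal_re]
    linear_combination (-z.J k l) * hy

namespace Represents

variable {W : Matrix (Fin n) (Fin n) ℂ} {z : SOCPVar n}

theorem apply_eq_lineEntry (h : N.Represents dir W z) (hdir : N.IsOrientation dir) {k l : Fin n}
    (hkl : dir k l) : W k l = N.lineEntry z k l := by
  have hy := N.normSq_y_mul (hdir.1 k l hkl)
  apply Complex.ext
  · simp only [lineEntry, h.w, h.P k l hkl, h.Q k l hkl, N.tr_Phi h.herm, N.tr_Psi h.herm, y_re,
      y_im]
    linear_combination ((W k k).re - (W k l).re) * hy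
  · simp only [lineEntry, h.P k l hkl, h.Q k l hkl, N.tr_Phi h.herm, N.tr_Psi h.herm, y_re, y_im]
    linear_combination (-(W k l).im) * hy

theorem voltageDrop (h : N.Represents dir W z) (hdir : N.IsOrientation dir) :
    N.VoltageDrop dir z := by
  intro k l hkl
  have hy := N.normSq_y_mul (hdir.1 k l hkl)
  simp only [h.w, h.P k l hkl, h.Q k l hkl, h.J k l hkl, N.tr_Phi h.herm, N.tr_Psi h.herm, y_re,
    y_im]
  linear_combination ((W k k).re - (W l l).re) * hy

theorem tr_Phi_rev (h : N.Represents dir W z) (hdir : N.IsOrientation dir) {k l : Fin n}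
    (hkl : dir k l) : tr (N.Phi l k) W = N.r k l * z.J k l - z.P k l := by
  have hW : W l k = star (W k l) := (h.herm.apply l k).symm
  rw [N.tr_Phi h.herm, h.P k l hkl, h.J k l hkl, N.tr_Phi h.herm, hW,
    ← N.y_symm k l (hdir.1 k l hkl), y_re, y_im]
  simp only [Complex.star_def, Complex.conj_re, Complex.conj_im]
  ring

theorem tr_Psi_rev (h : N.Represents dir W z) (hdir : N.IsOrientation dir) {k l : Fin n}
    (hkl : dir k l) : tr (N.Psi l k) W = N.x k l * z.J k l - z.Q k l := by
  have hW : W l k = star (W k l) := (h.herm.apply l k).symm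
  rw [N.tr_Psi h.herm, h.Q k l hkl, h.J k l hkl, N.tr_Psi h.herm, hW,
    ← N.y_symm k l (hdir.1 k l hkl), y_re, y_im]
  simp only [Complex.star_def, Complex.conj_re, Complex.conj_im]
  ring

theorem tr_PhiBus (h : N.Represents dir W z) (hdir : N.IsOrientation dir)
    (hshunt : ∀ k, N.y k k = 0) (k : Fin n) : tr (N.PhiBus k) W = N.injP dir z k := by
  classical
  rw [N.PhiBus_eq hshunt, tr_sum, injP, hdir.sum_adj, sub_eq_add_neg, ← Finset.sum_neg_distrib]
  congr 1
  · exact Finset.sum_congr rfl fun l hl => (h.P k l (Finset.mem_filter.1 hl).2).symm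
  · refine Finset.sum_congr rfl fun l hl => ?_
    rw [h.tr_Phi_rev hdir (Finset.mem_filter.1 hl).2]
    ring

theorem tr_PsiBus (h : N.Represents dir W z) (hdir : N.IsOrientation dir)
    (hshunt : ∀ k, N.y k k = 0) (k : Fin n) : tr (N.PsiBus k) W = N.injQ dir z k := by
  classical
  rw [N.PsiBus_eq hshunt, tr_sum, injQ, hdir.sum_adj, sub_eq_add_neg, ← Finset.sum_neg_distrib]
  congr 1
  · exact Finset.sum_congr rfl fun l hl => (h.Q k l (Finset.mem_filter.1 hl).2).symm
  · refine Finset.sum_congr rfl fun l hl => ?_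
    rw [h.tr_Psi_rev hdir (Finset.mem_filter.1 hl).2]
    ring

/-- By the minor inequality and AM-GM, `2 Re W_kl ≤ 2 √(W_kk W_ll) ≤ W_kk + W_ll`. -/
theorem J_nonneg (h : N.Represents dir W z) (hW : W.PosSemidef) {k l : Fin n} (hkl : dir k l) :
    0 ≤ z.J k l := by
  rw [h.J k l hkl]
  refine mul_nonneg (Complex.normSq_nonneg _) ?_
  have h1 := hW.normSq_le k l
  rw [Complex.normSq_apply] at h1
  have h2 := hW.re_diag_nonneg k
  have h3 := hW.re_diag_nonneg l
  nlinarith [sq_nonneg ((W k k).re - (W l l).re), mul_self_nonneg (W k l).im]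

/-- The slack `J w_k - P² - Q²` equals `|y|² (W_kk W_ll - |W_kl|²)`. -/
theorem soc (h : N.Represents dir W z) (hW : W.PosSemidef) {k l : Fin n} (hkl : dir k l) :
    z.P k l ^ 2 + z.Q k l ^ 2 ≤ z.J k l * z.w k := by
  have h1 := hW.normSq_le k l
  have h2 := Complex.normSq_nonneg (N.y k l)
  have hy := Complex.normSq_apply (N.y k l)
  rw [Complex.normSq_apply] at h1
  rw [h.J k l hkl, h.P k l hkl, h.Q k l hkl, N.tr_Phi h.herm, N.tr_Psi h.herm, h.w]
  have key : 0 ≤ Complex.normSq (N.y k l) * ((W k k).re * (W l l).re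
      - ((W k l).re * (W k l).re + (W k l).im * (W k l).im)) :=
    mul_nonneg h2 (by linarith)
  rw [← sub_nonneg]
  convert key using 1
  rw [hy]
  ring

end Represents

/-- For branch flow variables in the second-order cone that satisfy the voltage drop equations,
the `2 × 2` minors of a representing matrix are nonnegative. -/
theorem normSq_lineEntry_le (hdir : N.IsOrientation dir) {z : SOCPVar n}
    (hz : N.VoltageDrop dir z) {k l : Fin n} (hkl : dir k l)
    (hsoc : z.P k l ^ 2 + z.Q k l ^ 2 ≤ z.J k l * z.w k) :
    Complex.normSq (N.lineEntry z k l) ≤ z.w k * z.w l := by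
  have hp := (N.sq_add_sq_pos (hdir.1 k l hkl)).le
  have := mul_le_mul_of_nonneg_left hsoc hp
  rw [Complex.normSq_apply, hz k l hkl]
  simp only [lineEntry]
  nlinarith

/-! ### The Lagrangian of the second-order cone relaxation -/

variable (N) in
/-- Contribution of the directed line `k → l` to the terms of the Lagrangian that come from power
balance and from flow limits. -/
noncomputable def lineLagrangian (lamP lamQ : Fin n → ℝ) (mu muRev : Fin n → Fin n → ℝ) (z : SOCPVar n)
    (k l : Fin n) : ℝ :=
  lamP k * z.P k l - lamP l * (z.P k l - N.r k l * z.J k l)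
    + (lamQ k * z.Q k l - lamQ l * (z.Q k l - N.x k l * z.J k l))
    + (mu k l * z.P k l + muRev k l * (N.r k l * z.J k l - z.P k l))

variable (N) in
open Classical in
/-- The part of the Lagrangian that is linear in the network variables. -/
noncomputable def networkLagrangian (dir : Fin n → Fin n → Prop) (z : SOCPVar n) (m : SOCPMult n) : ℝ :=
  ∑ k, (m.vU k - m.vL k) * z.w k + ∑ k, ∑ l with dir k l,
    (N.lineLagrangian m.rhoP m.rhoQ m.mu m.muRev z k l
      + m.beta k l * (z.w l - (z.w k - 2 * (z.P k l * N.r k l + z.Q k l * N.x k l)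
              + (N.r k l ^ 2 + N.x k l ^ 2) * z.J k l))
      - (m.sP k l * z.P k l + m.sQ k l * z.Q k l + m.sJ k l * z.J k l + m.sw k l * z.w k))

variable (N) in
/-- The part of the Lagrangian that depends on the generation at bus `k`. -/
noncomputable def genLagrangian (m : SOCPMult n) (k : Fin n) (p q : ℝ) : ℝ :=
  N.c k (p, q) - (m.rhoP k - m.pU k + m.pL k) * p - (m.rhoQ k - m.qU k + m.qL k) * q

theorem exists_socpLagrangian_eq (N : PowerNetwork n) (dir : Fin n → Fin n → Prop)
    (m : SOCPMult n) : ∃ C : ℝ, ∀ z, N.socpLagrangian dir z m =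
      ∑ k, N.genLagrangian m k (z.pG k) (z.qG k) + N.networkLagrangian dir z m + C := by
  classical
  refine ⟨∑ k, (m.rhoP k * N.pD k + m.rhoQ k * N.qD k - m.pU k * N.pmax k + m.pL k * N.pmin k
    - m.qU k * N.qmax k + m.qL k * N.qmin k - m.vU k * N.vmax k ^ 2 + m.vL k * N.vmin k ^ 2)
    - ∑ k, ∑ l with dir k l, (m.mu k l * N.f k l + m.muRev k l * N.f k l), fun z => ?_⟩
  have hP := sum_mul_injP N dir z m.rhoP
  have hQ := sum_mul_injQ N dir z m.rhoQ
  simp only [socpLagrangian, genLagrangian, networkLagrangian, lineLagrangian, mul_add, mul_sub,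
    add_mul, sub_mul, Finset.sum_add_distrib, Finset.sum_sub_distrib] at hP hQ ⊢
  linarith

open Classical in
theorem networkLagrangian_line (N : PowerNetwork n) (dir : Fin n → Fin n → Prop) (m : SOCPMult n)
    (z u v : SOCPVar n) (t : ℝ) (hw : ∀ k, v.w k = z.w k + t * u.w k)
    (hP : ∀ k l, v.P k l = z.P k l + t * u.P k l) (hQ : ∀ k l, v.Q k l = z.Q k l + t * u.Q k l)
    (hJ : ∀ k l, v.J k l = z.J k l + t * u.J k l) :
    N.networkLagrangian dir v m
      = N.networkLagrangian dir z m + t * N.networkLagrangian dir u m := by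
  simp only [networkLagrangian, lineLagrangian, mul_add t, Finset.mul_sum, hw, hP, hQ, hJ]
  refine Eq.trans (congrArg₂ (· + ·) ?_ ?_) (add_add_add_comm _ _ _ _)
  · rw [← Finset.sum_add_distrib]
    exact Finset.sum_congr rfl fun k _ => by ring
  · rw [← Finset.sum_add_distrib]
    refine Finset.sum_congr rfl fun k _ => ?_
    rw [← Finset.sum_add_distrib]
    exact Finset.sum_congr rfl fun l _ => by ring

theorem networkLagrangian_congr (N : PowerNetwork n) (dir : Fin n → Fin n → Prop)
    (m : SOCPMult n) {z z' : SOCPVar n} (hw : z.w = z'.w) (hP : z.P = z'.P) (hQ : z.Q = z'.Q)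
    (hJ : z.J = z'.J) : N.networkLagrangian dir z m = N.networkLagrangian dir z' m := by
  simp only [networkLagrangian, lineLagrangian, hw, hP, hQ, hJ]

/-- The Lagrangian is minimal at `z` iff its generation part satisfies the subgradient inequality
at every bus and its network part vanishes. -/
theorem socpLagrangian_minimal_iff (N : PowerNetwork n) (dir : Fin n → Fin n → Prop)
    (z : SOCPVar n) (m : SOCPMult n) :
    (∀ z', N.socpLagrangian dir z m ≤ N.socpLagrangian dir z' m) ↔
      (∀ k p q, N.c k (z.pG k, z.qG k) + (m.rhoP k - m.pU k + m.pL k) * (p - z.pG k)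
        + (m.rhoQ k - m.qU k + m.qL k) * (q - z.qG k) ≤ N.c k (p, q)) ∧
      ∀ u, N.networkLagrangian dir u m = 0 := by
  classical
  obtain ⟨C, hC⟩ := exists_socpLagrangian_eq N dir m
  simp only [hC]
  constructor
  · intro h
    constructor
    · intro k p q
      have h1 := h { z with pG := Function.update z.pG k p, qG := Function.update z.qG k q }
      rw [networkLagrangian_congr N dir m (z' := z)
        (z := { z with pG := Function.update z.pG k p, qG := Function.update z.qG k q })
        rfl rfl rfl rfl, ← Finset.add_sum_erase _ _ (Finset.mem_univ k),
        ← Finset.add_sum_erase _ _ (Finset.mem_univ k)] at h1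
      have h2 : ∑ j ∈ Finset.univ.erase k, N.genLagrangian m j (Function.update z.pG k p j)
            (Function.update z.qG k q j)
          = ∑ j ∈ Finset.univ.erase k, N.genLagrangian m j (z.pG j) (z.qG j) := by
        refine Finset.sum_congr rfl fun j hj => ?_
        rw [Function.update_of_ne (Finset.ne_of_mem_erase hj),
          Function.update_of_ne (Finset.ne_of_mem_erase hj)]
      rw [h2] at h1
      simp only [Function.update_self, genLagrangian] at h1
      linarith
    · intro u
      -- The network part is linear, so minimality along the line `z + t u`, for `t` of both signs,
      -- forces it to vanish at `u`.
      have h1 : ∀ t : ℝ, 0 ≤ t * N.networkLagrangian dir u m := by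
        intro t
        have h2 := h ⟨z.pG, z.qG, fun k => z.w k + t * u.w k, fun k l => z.P k l + t * u.P k l,
          fun k l => z.Q k l + t * u.Q k l, fun k l => z.J k l + t * u.J k l⟩
        rw [networkLagrangian_line N dir m z u ⟨z.pG, z.qG, fun k => z.w k + t * u.w k,
          fun k l => z.P k l + t * u.P k l, fun k l => z.Q k l + t * u.Q k l,
          fun k l => z.J k l + t * u.J k l⟩ t (fun _ => rfl) (fun _ _ => rfl) (fun _ _ => rfl)
          (fun _ _ => rfl)] at h2
        linarith
      linarith [h1 1, h1 (-1)]
  · rintro ⟨h1, h2⟩ z'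
    rw [h2 z, h2 z']
    gcongr with k
    have := h1 k (z'.pG k) (z'.qG k)
    simp only [genLagrangian]
    linarith

/-! ### The dual matrix of the semidefinite relaxation -/

variable (N) in
open Classical in
/-- The gradient in `W` of the Lagrangian of the semidefinite relaxation, apart from the
multiplier of `W ⪰ 0`. -/
noncomputable def dualMatrix (lamP lamQ : Fin n → ℝ) (mu : Fin n → Fin n → ℝ) (vU vL : Fin n → ℝ) :
    Matrix (Fin n) (Fin n) ℂ :=
  ∑ k, (lamP k : ℂ) • N.PhiBus k + ∑ k, (lamQ k : ℂ) • N.PsiBus k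
    + ∑ k, ∑ l with N.graph.Adj k l, (mu k l : ℂ) • N.Phi k l
    + ∑ k, (vU k : ℂ) • Matrix.single k k 1
    - ∑ k, (vL k : ℂ) • Matrix.single k k 1

open Classical in
-- The bridge between the two Lagrangians. The SDP flow multiplier of the opposite direction, `mu l
-- k`, plays the role of `muRev k l`.
theorem Represents.tr_dualMatrix {W : Matrix (Fin n) (Fin n) ℂ} {z : SOCPVar n}
    (h : N.Represents dir W z) (hdir : N.IsOrientation dir) (hshunt : ∀ k, N.y k k = 0)
    (lamP lamQ : Fin n → ℝ) (mu : Fin n → Fin n → ℝ) (vU vL : Fin n → ℝ) :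
    tr (N.dualMatrix lamP lamQ mu vU vL) W = ∑ k, (vU k - vL k) * z.w k
      + ∑ k, ∑ l with dir k l, N.lineLagrangian lamP lamQ mu (fun k l => mu l k) z k l := by
  simp only [dualMatrix, tr_add, tr_sub, tr_sum, tr_ofReal_smul, h.tr_PhiBus hdir hshunt,
    h.tr_PsiBus hdir hshunt, tr_single, one_mul, ← h.w, lineLagrangian, sub_mul,
    Finset.sum_sub_distrib, sum_mul_injP, sum_mul_injQ]
  have h1 : ∑ k, ∑ l with N.graph.Adj k l, mu k l * tr (N.Phi k l) W
      = ∑ k, ∑ l with dir k l,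
        (mu k l * z.P k l + mu l k * (N.r k l * z.J k l - z.P k l)) := by
    rw [hdir.sum_sum_adj]
    refine Finset.sum_congr rfl fun k _ => Finset.sum_congr rfl fun l hl => ?_
    have hkl := (Finset.mem_filter.1 hl).2
    rw [h.P k l hkl, h.tr_Phi_rev hdir hkl, h.P k l hkl]
  rw [h1]
  simp only [Finset.sum_add_distrib, Finset.sum_sub_distrib]
  ring

theorem isHermitian_ofReal_smul {A : Matrix (Fin n) (Fin n) ℂ} (hA : A.IsHermitian) (a : ℝ) :
    ((a : ℂ) • A).IsHermitian := by
  rw [Matrix.IsHermitian, Matrix.conjTranspose_smul, hA.eq, Complex.star_def, Complex.conj_ofReal]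

theorem isHermitian_sum {ι : Type*} (s : Finset ι) {A : ι → Matrix (Fin n) (Fin n) ℂ}
    (hA : ∀ i ∈ s, (A i).IsHermitian) : (∑ i ∈ s, A i).IsHermitian := by
  rw [Matrix.IsHermitian, Matrix.conjTranspose_sum]
  exact Finset.sum_congr rfl fun i hi => (hA i hi).eq

theorem dualMatrix_isHermitian (hshunt : ∀ k, N.y k k = 0) (lamP lamQ : Fin n → ℝ)
    (mu : Fin n → Fin n → ℝ) (vU vL : Fin n → ℝ) :
    (N.dualMatrix lamP lamQ mu vU vL).IsHermitian := by
  classical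
  have h1 : ∀ k : Fin n, (Matrix.single k k (1 : ℂ)).IsHermitian := fun k => by
    simp [Matrix.IsHermitian, Matrix.conjTranspose_single]
  simp only [dualMatrix, N.PhiBus_eq hshunt, N.PsiBus_eq hshunt]
  refine ((((Matrix.IsHermitian.add ?_ ?_).add ?_).add ?_).sub ?_)
  · exact isHermitian_sum _ fun k _ => isHermitian_ofReal_smul
      (isHermitian_sum _ fun l _ => N.Phi_isHermitian k l) _
  · exact isHermitian_sum _ fun k _ => isHermitian_ofReal_smul
      (isHermitian_sum _ fun l _ => N.Psi_isHermitian k l) _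
  · exact isHermitian_sum _ fun k _ => isHermitian_sum _ fun l _ =>
      isHermitian_ofReal_smul (N.Phi_isHermitian k l) _
  · exact isHermitian_sum _ fun k _ => isHermitian_ofReal_smul (h1 k) _
  · exact isHermitian_sum _ fun k _ => isHermitian_ofReal_smul (h1 k) _

theorem Phi_apply_of_not_adj {i j : Fin n} (hij : i ≠ j) (h : ¬ N.graph.Adj i j) {k l : Fin n}
    (hkl : N.graph.Adj k l) : N.Phi k l i j = 0 := by
  have h1 : ¬ (k = i ∧ l = j) := by
    rintro ⟨rfl, rfl⟩
    exact h hkl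
  have h2 : ¬ (l = i ∧ k = j) := by
    rintro ⟨rfl, rfl⟩
    exact h hkl.symm
  have h3 : ¬ (k = i ∧ k = j) := by
    rintro ⟨rfl, rfl⟩
    exact hij rfl
  simp only [Phi, Matrix.add_apply, Matrix.single_apply, if_neg h1, if_neg h2, if_neg h3, add_zero]

theorem Psi_apply_of_not_adj {i j : Fin n} (hij : i ≠ j) (h : ¬ N.graph.Adj i j) {k l : Fin n}
    (hkl : N.graph.Adj k l) : N.Psi k l i j = 0 := by
  have h1 : ¬ (k = i ∧ l = j) := by
    rintro ⟨rfl, rfl⟩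
    exact h hkl
  have h2 : ¬ (l = i ∧ k = j) := by
    rintro ⟨rfl, rfl⟩
    exact h hkl.symm
  have h3 : ¬ (k = i ∧ k = j) := by
    rintro ⟨rfl, rfl⟩
    exact hij rfl
  simp only [Psi, Matrix.add_apply, Matrix.single_apply, if_neg h1, if_neg h2, if_neg h3, add_zero]

theorem dualMatrix_apply_of_not_adj (hshunt : ∀ k, N.y k k = 0) (lamP lamQ : Fin n → ℝ)
    (mu : Fin n → Fin n → ℝ) (vU vL : Fin n → ℝ) {i j : Fin n} (hij : i ≠ j)
    (h : ¬ N.graph.Adj i j) : N.dualMatrix lamP lamQ mu vU vL i j = 0 := by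
  classical
  have h1 : ∀ k : Fin n, Matrix.single k k (1 : ℂ) i j = 0 := by
    intro k
    rw [Matrix.single_apply, if_neg]
    rintro ⟨rfl, rfl⟩
    exact hij rfl
  have h2 : ∀ (a : Fin n → ℂ) k, ∑ l with N.graph.Adj k l, a l * N.Phi k l i j = 0 :=
    fun a k => Finset.sum_eq_zero fun l hl => by
      rw [Phi_apply_of_not_adj hij h (Finset.mem_filter.1 hl).2, mul_zero]
  have h3 : ∀ (a : Fin n → ℂ) k, ∑ l with N.graph.Adj k l, a l * N.Psi k l i j = 0 :=
    fun a k => Finset.sum_eq_zero fun l hl => by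
      rw [Psi_apply_of_not_adj hij h (Finset.mem_filter.1 hl).2, mul_zero]
  simp only [dualMatrix, N.PhiBus_eq hshunt, N.PsiBus_eq hshunt, Matrix.sub_apply,
    Matrix.add_apply, Matrix.sum_apply, Matrix.smul_apply, smul_eq_mul, Finset.mul_sum, h1, h2, h3]
  simp

end PowerNetwork

/-! ### Edge blocks and the dual cone -/

/-- This is the trace of a product of two positive semidefinite `2 × 2` matrices: `2 |Re(u conj(c))|
≤ 2 √(ab·st) ≤ as + bt`. -/
theorem add_add_two_mul_nonneg_of_normSq_le {a b s t : ℝ} {u c : ℂ} (ha : 0 ≤ a) (hb : 0 ≤ b)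
    (hs : 0 ≤ s) (ht : 0 ≤ t) (hu : Complex.normSq u ≤ a * b) (hc : Complex.normSq c ≤ s * t) :
    0 ≤ a * s + b * t + 2 * (u.re * c.re + u.im * c.im) := by
  have h1 : Complex.normSq u * Complex.normSq c ≤ (a * b) * (s * t) :=
    mul_le_mul hu hc (Complex.normSq_nonneg _) (mul_nonneg ha hb)
  rw [Complex.normSq_apply, Complex.normSq_apply] at h1
  have h2 : (2 * (u.re * c.re + u.im * c.im)) ^ 2 ≤ (a * s + b * t) ^ 2 := by
    nlinarith [sq_nonneg (u.re * c.im - u.im * c.re), sq_nonneg (a * s - b * t)]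
  have h3 := abs_le_of_sq_le_sq' h2 (add_nonneg (mul_nonneg ha hs) (mul_nonneg hb ht))
  linarith [h3.1]

namespace PowerNetwork

/-- The linear form on `(P, Q, J, w)` that corresponds, on a line of resistance `r` and reactance
`x`, to the positive semidefinite matrix with diagonal `(a, b)` and off-diagonal entry `u`, lies in
the dual cone. -/
theorem inDualSOC_of_normSq_le {a b r x : ℝ} {u : ℂ} (ha : 0 ≤ a) (hb : 0 ≤ b)
    (hu : Complex.normSq u ≤ a * b) :
    InDualSOC (-2 * b * r + 2 * (u.im * x - u.re * r)) (-2 * b * x - 2 * (u.re * x + u.im * r))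
      (b * (r ^ 2 + x ^ 2)) (a + b + 2 * u.re) := by
  intro P Q J w hJ hw hPQ
  have hrx : 0 ≤ r ^ 2 + x ^ 2 := by positivity
  have hm := mul_le_mul_of_nonneg_left hPQ hrx
  -- A point of the cone is turned back into a `2 × 2` matrix: diagonal `w` and the far-end value
  -- given by the voltage drop, off-diagonal entry as in `lineEntry`. The linear form is its trace
  -- against the block `(a, b, u)`.
  have hc : Complex.normSq ⟨w - (P * r + Q * x), P * x - Q * r⟩
      ≤ w * (w - 2 * (P * r + Q * x) + (r ^ 2 + x ^ 2) * J) := by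
    rw [Complex.normSq_apply]
    nlinarith
  have ht : 0 ≤ w - 2 * (P * r + Q * x) + (r ^ 2 + x ^ 2) * J := by
    rcases hw.eq_or_lt with h | h
    · rw [← h, mul_zero] at hPQ
      have hP : P = 0 := by nlinarith [sq_nonneg P, sq_nonneg Q]
      have hQ : Q = 0 := by nlinarith [sq_nonneg P, sq_nonneg Q]
      rw [← h, hP, hQ]
      have := mul_nonneg hrx hJ
      linarith
    · exact nonneg_of_mul_nonneg_right (le_trans (Complex.normSq_nonneg _) hc) h
  have := add_add_two_mul_nonneg_of_normSq_le ha hb hw ht hu hc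
  linarith

variable {n : ℕ} {N : PowerNetwork n} {dir : Fin n → Fin n → Prop}

open Classical in
/-- `Tr (U W)` as a sum over buses and directed lines. -/
theorem IsOrientation.tr_eq_sum (hdir : N.IsOrientation dir) {U W : Matrix (Fin n) (Fin n) ℂ}
    (hU : U.IsHermitian) (hW : W.IsHermitian)
    (hUG : ∀ i j, i ≠ j → ¬ N.graph.Adj i j → U i j = 0) :
    tr U W = ∑ k, (U k k).re * (W k k).re + ∑ k, ∑ l with dir k l,
        2 * ((U k l).re * (W k l).re + (U k l).im * (W k l).im) := by
  have h1 : ∀ k, ∑ l, (U k l * W l k).re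
      = (U k k).re * (W k k).re + ∑ l with N.graph.Adj k l, (U k l * W l k).re := by
    intro k
    rw [← Finset.add_sum_erase _ _ (Finset.mem_univ k)]
    congr 1
    · simp [hU.im_diag_eq_zero]
    · refine (Finset.sum_subset (fun l hl => ?_) fun l hl hn => ?_).symm
      · simpa using (Finset.mem_filter.1 hl).2.ne'
      · rw [hUG k l (Finset.ne_of_mem_erase hl).symm (by simpa using hn)]
        simp
  have h2 : tr U W = ∑ k, ∑ l, (U k l * W l k).re := by
    simp only [tr, Matrix.trace, Matrix.diag_apply, Matrix.mul_apply, Complex.re_sum]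
  simp only [h2, h1, Finset.sum_add_distrib]
  rw [hdir.sum_sum_adj]
  congr 1
  refine Finset.sum_congr rfl fun k _ => Finset.sum_congr rfl fun l _ => ?_
  rw [← hU.apply l k, ← hW.apply l k]
  simp only [Complex.mul_re, Complex.star_def, Complex.conj_re, Complex.conj_im]
  ring

/-- The Hermitian matrix whose entries on the lines are those prescribed by `z`. -/
theorem IsOrientation.exists_represents (hdir : N.IsOrientation dir) {z : SOCPVar n}
    (hz : N.VoltageDrop dir z) : ∃ W, N.Represents dir W z := by
  classical
  set W : Matrix (Fin n) (Fin n) ℂ := Matrix.of fun i j =>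
    if i = j then (z.w i : ℂ) else if dir i j then N.lineEntry z i j
    else if dir j i then star (N.lineEntry z j i) else 0 with hWdef
  refine ⟨W, represents_of_lineEntry hdir hz ?_ (fun k => by simp [hWdef]) fun k l hkl => ?_⟩
  · ext i j
    simp only [hWdef, Matrix.conjTranspose_apply, Matrix.of_apply]
    by_cases hij : i = j
    · subst hij
      simp
    · by_cases h1 : dir i j
      · simp [hij, Ne.symm hij, h1, hdir.not_dir h1]
      · by_cases h2 : dir j i
        · simp [hij, Ne.symm hij, h1, h2]
        · simp [hij, Ne.symm hij, h1, h2]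
  · simp [hWdef, hkl, (hdir.1 k l hkl).ne]

/-! ### The two inclusions -/

theorem SOCPFeasible.w_nonneg {z : SOCPVar n} (h : N.SOCPFeasible dir z) (k : Fin n) :
    0 ≤ z.w k :=
  (sq_nonneg _).trans (h.voltage k).1

/-- The forest serves only to split the dual matrix `U`; the primal point is read off from `W`
directly. -/
theorem sdpLMPs_subset (hradial : N.graph.IsAcyclic) (hshunt : ∀ k, N.y k k = 0)
    (hdir : N.IsOrientation dir) : N.sdpLMPs ⊆ N.socpDLMPs dir := by
  classical
  rintro _ ⟨W, pG, qG, m, h, rfl⟩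
  have hW := h.primal.psd
  have hUd : m.U = N.dualMatrix m.lamP m.lamQ m.mu m.vU m.vL := (sub_eq_zero.1 h.stat_W).symm
  have hUG : ∀ i j, i ≠ j → ¬ N.graph.Adj i j → m.U i j = 0 := fun i j hij hn => by
    rw [hUd]
    exact dualMatrix_apply_of_not_adj hshunt _ _ _ _ _ hij hn
  obtain ⟨a, ha0, hae, had⟩ := h.U_psd.exists_edge_decomposition hradial hUG
  set z := N.branchPoint W pG qG with hz
  have hR : N.Represents dir W z := represents_branchPoint dir hW.1 pG qG
  -- The diagonal left over once the edge blocks are removed from `U`.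
  set D : Fin n → ℝ := fun k => (m.U k k).re - ∑ l with N.graph.Adj k l, a k l with hD
  have hD0 : ∀ k, 0 ≤ D k := fun k => sub_nonneg.2 (had k)
  -- The coefficients of `inDualSOC_of_normSq_le` for the block with diagonal `(a k l, a l k)` and
  -- off-diagonal entry `U k l`.
  set sP : Fin n → Fin n → ℝ := fun k l => -2 * a l k * N.r k l
    + 2 * ((m.U k l).im * N.x k l - (m.U k l).re * N.r k l) with hsP
  set sQ : Fin n → Fin n → ℝ := fun k l => -2 * a l k * N.x k l
    - 2 * ((m.U k l).re * N.x k l + (m.U k l).im * N.r k l) with hsQ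
  set sJ : Fin n → Fin n → ℝ := fun k l => a l k * (N.r k l ^ 2 + N.x k l ^ 2) with hsJ
  set sw : Fin n → Fin n → ℝ := fun k l => a k l + a l k + 2 * (m.U k l).re with hsw
  have hdual : ∀ k l, dir k l → InDualSOC (sP k l) (sQ k l) (sJ k l) (sw k l) := fun k l hkl =>
    inDualSOC_of_normSq_le (ha0 k l) (ha0 l k) (hae k l (hdir.1 k l hkl))
  have htr : ∀ (W' : Matrix (Fin n) (Fin n) ℂ) (u : SOCPVar n), N.Represents dir W' u →
      tr m.U W' = ∑ k, D k * u.w k + ∑ k, ∑ l with dir k l,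
        (sP k l * u.P k l + sQ k l * u.Q k l + sJ k l * u.J k l + sw k l * u.w k) := by
    intro W' u hu
    have h1 : ∑ k, ∑ l with N.graph.Adj k l, a k l * u.w k
        = ∑ k, ∑ l with dir k l, (a k l * u.w k + a l k * u.w l) :=
      hdir.sum_sum_adj fun k l => a k l * u.w k
    rw [hdir.tr_eq_sum h.U_psd.1 hu.herm hUG]
    simp only [hD, sub_mul, Finset.sum_sub_distrib, Finset.sum_mul, h1, ← hu.w]
    rw [sub_add, ← Finset.sum_sub_distrib, sub_eq_add_neg, ← Finset.sum_neg_distrib]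
    congr 1
    refine Finset.sum_congr rfl fun k _ => ?_
    rw [← Finset.sum_sub_distrib, ← Finset.sum_neg_distrib]
    refine Finset.sum_congr rfl fun l hl => ?_
    have hkl := (Finset.mem_filter.1 hl).2
    rw [hu.apply_eq_lineEntry hdir hkl, hu.voltageDrop hdir k l hkl]
    simp only [lineEntry, hsP, hsQ, hsJ, hsw]
    ring
  have hzw : ∀ k, 0 ≤ z.w k := fun k => by
    rw [hR.w]
    exact hW.re_diag_nonneg k
  have hs0 : ∀ k l, dir k l →
      0 ≤ sP k l * z.P k l + sQ k l * z.Q k l + sJ k l * z.J k l + sw k l * z.w k :=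
    fun k l hkl => hdual k l hkl _ _ _ _ (hR.J_nonneg hW hkl) (hzw k) (hR.soc hW hkl)
  have hDw0 : ∀ k, 0 ≤ D k * z.w k := fun k => mul_nonneg (hD0 k) (hzw k)
  have hss0 : ∀ k, 0 ≤ ∑ l with dir k l,
      (sP k l * z.P k l + sQ k l * z.Q k l + sJ k l * z.J k l + sw k l * z.w k) :=
    fun k => Finset.sum_nonneg fun l hl => hs0 k l (Finset.mem_filter.1 hl).2
  -- `Tr (U W) = 0` is a sum of nonnegative terms, so slackness holds on each line and at each bus.
  have hzero := htr W z hR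
  rw [h.cs_psd, eq_comm, add_eq_zero_iff_of_nonneg (Finset.sum_nonneg fun k _ => hDw0 k)
    (Finset.sum_nonneg fun k _ => hss0 k), Finset.sum_eq_zero_iff_of_nonneg fun k _ => hDw0 k,
    Finset.sum_eq_zero_iff_of_nonneg fun k _ => hss0 k] at hzero
  have hDz : ∀ k, D k * z.w k = 0 := fun k => hzero.1 k (Finset.mem_univ k)
  have hsz : ∀ k l, dir k l →
      sP k l * z.P k l + sQ k l * z.Q k l + sJ k l * z.J k l + sw k l * z.w k = 0 :=
    fun k l hkl => (Finset.sum_eq_zero_iff_of_nonneg fun l hl =>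
      hs0 k l (Finset.mem_filter.1 hl).2).1 (hzero.2 k (Finset.mem_univ k)) l (by simpa using hkl)
  have htv : ∀ k, tr (Matrix.single k k 1) W = z.w k := fun k => by rw [tr_single, one_mul, hR.w]
  have hprimal := h.primal
  let m' : SOCPMult n :=
    { rhoP := m.lamP, rhoQ := m.lamQ, pU := m.pU, pL := m.pL, qU := m.qU, qL := m.qL, vU := m.vU
      -- The SOCP has no separate multiplier for `w ≥ 0`, so `D` goes to the lower voltage limit.
      -- Slackness survives: where `D k ≠ 0`, `w k = 0`, hence `vmin k ^ 2 = 0` and the limit is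
      -- tight.
      vL := fun k => m.vL k + D k
      mu := m.mu
      muRev := fun k l => m.mu l k
      -- Chosen so that the coefficient of `J k l` in the Lagrangian vanishes.
      beta := fun k l => (m.lamP l * N.r k l + m.lamQ l * N.x k l + m.mu l k * N.r k l - sJ k l)
        / (N.r k l ^ 2 + N.x k l ^ 2)
      sP := sP, sQ := sQ, sJ := sJ, sw := sw }
  refine ⟨z, m', ?_, rfl⟩
  constructor
  · exact
      { p_balance := fun k => (hprimal.p_balance k).trans (hR.tr_PhiBus hdir hshunt k)
        q_balance := fun k => (hprimal.q_balance k).trans (hR.tr_PsiBus hdir hshunt k)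
        flow := fun k l hkl => hprimal.flow k l (hdir.1 k l hkl)
        flow_rev := fun k l hkl => by
          rw [← hR.tr_Phi_rev hdir hkl, N.f_symm k l (hdir.1 k l hkl)]
          exact hprimal.flow l k (hdir.1 k l hkl).symm
        p_bounds := hprimal.p_bounds
        q_bounds := hprimal.q_bounds
        voltage := fun k => by
          rw [← htv]
          exact hprimal.voltage k
        drop := hR.voltageDrop hdir
        soc := fun k l hkl => hR.soc hW hkl }
  · exact h.gen_nonneg
  · exact fun k => ⟨(h.v_nonneg k).1, add_nonneg (h.v_nonneg k).2 (hD0 k)⟩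
  · exact fun k l hkl =>
      ⟨h.mu_nonneg k l (hdir.1 k l hkl), h.mu_nonneg l k (hdir.1 k l hkl).symm⟩
  · exact hdual
  · rw [socpLagrangian_minimal_iff]
    refine ⟨h.stat_gen, fun u => ?_⟩
    -- Since `J` has coefficient zero, it may be reset to satisfy the voltage drop equations; `v`
    -- then comes from a Hermitian matrix, and SDP stationarity applies.
    set v : SOCPVar n := { u with
      J := fun k l => (u.w l - u.w k + 2 * (u.P k l * N.r k l + u.Q k l * N.x k l))
        / (N.r k l ^ 2 + N.x k l ^ 2) } with hv
    have hvd : N.VoltageDrop dir v := by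
      intro k l hkl
      have hpos := N.sq_add_sq_pos (hdir.1 k l hkl)
      simp only [hv]
      rw [mul_div_cancel₀ _ hpos.ne']
      ring
    have huv : N.networkLagrangian dir u m' = N.networkLagrangian dir v m' := by
      simp only [networkLagrangian]
      congr 1
      refine Finset.sum_congr rfl fun k _ => Finset.sum_congr rfl fun l hl => ?_
      have hkl := (Finset.mem_filter.1 hl).2
      have hpos := N.sq_add_sq_pos (hdir.1 k l hkl)
      have hβ : m'.beta k l * (N.r k l ^ 2 + N.x k l ^ 2)
          = m.lamP l * N.r k l + m.lamQ l * N.x k l + m.mu l k * N.r k l - sJ k l :=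
        div_mul_cancel₀ _ hpos.ne'
      simp only [lineLagrangian]
      linear_combination (v.J k l - u.J k l) * hβ
    rw [huv]
    obtain ⟨W', hR'⟩ := hdir.exists_represents hvd
    have h1 := hR'.tr_dualMatrix hdir hshunt m.lamP m.lamQ m.mu m.vU m.vL
    rw [← hUd, htr W' v hR'] at h1
    have h2 : ∑ k, ∑ l with dir k l, m'.beta k l * (v.w l - (v.w k
        - 2 * (v.P k l * N.r k l + v.Q k l * N.x k l)
        + (N.r k l ^ 2 + N.x k l ^ 2) * v.J k l)) = 0 :=
      Finset.sum_eq_zero fun k _ => Finset.sum_eq_zero fun l hl => by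
        rw [← hvd k l (Finset.mem_filter.1 hl).2, sub_self, mul_zero]
    have h3 : ∑ k, (m'.vU k - m'.vL k) * v.w k
        = ∑ k, (m.vU k - m.vL k) * v.w k - ∑ k, D k * v.w k := by
      rw [← Finset.sum_sub_distrib]
      exact Finset.sum_congr rfl fun k _ => by
        simp only [m']
        ring
    simp only [networkLagrangian]
    rw [h3]
    simp only [Finset.sum_sub_distrib, Finset.sum_add_distrib] at h1 h2 ⊢
    simp only [m'] at h2 ⊢
    linarith
  · exact fun k l hkl => h.cs_flow k l (hdir.1 k l hkl)
  · intro k l hkl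
    have := h.cs_flow l k (hdir.1 k l hkl).symm
    rwa [hR.tr_Phi_rev hdir hkl, ← N.f_symm k l (hdir.1 k l hkl)] at this
  · intro k
    rw [← htv]
    exact h.cs_vU k
  · intro k
    have h1 := h.cs_vL k
    rw [htv] at h1
    have h2 : D k * (z.w k - N.vmin k ^ 2) = 0 := by
      rcases mul_eq_zero.1 (hDz k) with h0 | h0
      · rw [h0, zero_mul]
      · have h3 := (hprimal.voltage k).1
        rw [htv, h0] at h3
        rw [h0, le_antisymm h3 (sq_nonneg _), sub_self, mul_zero]
    change (m.vL k + D k) * (z.w k - N.vmin k ^ 2) = 0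
    rw [add_mul, h1, h2, add_zero]
  · exact h.cs_qL
  · exact h.cs_qU
  · exact h.cs_pL
  · exact h.cs_pU
  · exact hsz

/-- Here the forest serves only to complete the primal matrix `W`; no decomposition of `U` is
needed. -/
theorem socpDLMPs_subset (hradial : N.graph.IsAcyclic) (hshunt : ∀ k, N.y k k = 0)
    (hdir : N.IsOrientation dir) : N.socpDLMPs dir ⊆ N.sdpLMPs := by
  classical
  rintro _ ⟨z, m, h, rfl⟩
  have hprimal := h.primal
  set c : Fin n → Fin n → ℂ := fun k l =>
    if dir k l then N.lineEntry z k l else star (N.lineEntry z l k) with hc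
  have hor : ∀ k l, N.graph.Adj k l → dir k l ∨ dir l k := fun k l hkl => (hdir.2 k l hkl).or
  have hcs : ∀ k l, N.graph.Adj k l → c l k = star (c k l) := by
    intro k l hkl
    rcases hor k l hkl with h1 | h1
    · simp [hc, h1, hdir.not_dir h1]
    · simp [hc, h1, hdir.not_dir h1]
  have hcw : ∀ k l, N.graph.Adj k l → Complex.normSq (c k l) ≤ z.w k * z.w l := by
    intro k l hkl
    rcases hor k l hkl with h1 | h1
    · simpa [hc, h1] using normSq_lineEntry_le hdir hprimal.drop h1 (hprimal.soc k l h1)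
    · rw [mul_comm]
      simpa [hc, h1, hdir.not_dir h1, Complex.normSq_conj] using
        normSq_lineEntry_le hdir hprimal.drop h1 (hprimal.soc l k h1)
  obtain ⟨W, hW, hWd, hWe⟩ :=
    Matrix.exists_posSemidef_completion hradial z.w hprimal.w_nonneg c hcs hcw
  have hR : N.Represents dir W z := represents_of_lineEntry hdir hprimal.drop hW.1 hWd
    fun k l hkl => by rw [hWe k l (hdir.1 k l hkl)]; simp [hc, hkl]
  obtain ⟨hgen, hnet⟩ := (socpLagrangian_minimal_iff N dir z m).1 h.stationary
  -- The two flow multipliers of a directed line belong to its two directions.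
  set mu : Fin n → Fin n → ℝ := fun k l => if dir k l then m.mu k l else m.muRev l k with hmu
  set U := N.dualMatrix m.rhoP m.rhoQ mu m.vU m.vL with hU
  have hUh : U.IsHermitian := dualMatrix_isHermitian hshunt _ _ _ _ _
  have htr : ∀ (W' : Matrix (Fin n) (Fin n) ℂ) (u : SOCPVar n), N.Represents dir W' u →
      tr U W' = ∑ k, ∑ l with dir k l,
        (m.sP k l * u.P k l + m.sQ k l * u.Q k l + m.sJ k l * u.J k l + m.sw k l * u.w k) := by
    intro W' u hu
    have h1 := hnet u
    rw [hU, hu.tr_dualMatrix hdir hshunt]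
    rw [networkLagrangian] at h1
    rw [← sub_eq_zero, ← h1, add_sub_assoc, ← Finset.sum_sub_distrib]
    congr 1
    refine Finset.sum_congr rfl fun k _ => ?_
    rw [← Finset.sum_sub_distrib]
    refine Finset.sum_congr rfl fun l hl => ?_
    have hkl := (Finset.mem_filter.1 hl).2
    rw [← hu.voltageDrop hdir k l hkl]
    simp only [lineLagrangian, hmu, if_pos hkl, if_neg (hdir.not_dir hkl)]
    ring
  -- `v* U v = Tr (U v v*)`, and the branch flow variables of `v v*` lie in the cone of every line,
  -- so the dual cone multipliers make the trace nonnegative.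
  have hUpsd : U.PosSemidef := by
    refine Matrix.PosSemidef.of_dotProduct_mulVec_nonneg hUh fun v => ?_
    have hV := Matrix.posSemidef_vecMulVec_self_star v
    have hRV := represents_branchPoint (N := N) dir hV.1 z.pG z.qG
    have h1 := htr _ _ hRV
    have h2 : 0 ≤ tr U (Matrix.vecMulVec v (star v)) := by
      rw [h1]
      refine Finset.sum_nonneg fun k _ => Finset.sum_nonneg fun l hl => ?_
      have hkl := (Finset.mem_filter.1 hl).2
      refine h.s_dual k l hkl _ _ _ _ (hRV.J_nonneg hV hkl) ?_ (hRV.soc hV hkl)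
      rw [hRV.w]
      exact hV.re_diag_nonneg k
    have h3 : (U * Matrix.vecMulVec v (star v)).trace = star v ⬝ᵥ (U *ᵥ v) := by
      rw [Matrix.mul_vecMulVec, Matrix.trace_vecMulVec, dotProduct_comm]
    rw [tr, h3] at h2
    exact Complex.nonneg_iff.2 ⟨h2, (hUh.im_star_dotProduct_mulVec_self v).symm⟩
  have htv : ∀ k, tr (Matrix.single k k 1) W = z.w k := fun k => by rw [tr_single, one_mul, hR.w]
  let m' : SDPMult n :=
    { lamP := m.rhoP, lamQ := m.rhoQ, pU := m.pU, pL := m.pL, qU := m.qU, qL := m.qL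
      mu := mu, vU := m.vU, vL := m.vL, U := U }
  refine ⟨W, z.pG, z.qG, m', ?_, rfl⟩
  constructor
  · exact
      { p_bounds := hprimal.p_bounds
        q_bounds := hprimal.q_bounds
        p_balance := fun k => (hprimal.p_balance k).trans (hR.tr_PhiBus hdir hshunt k).symm
        q_balance := fun k => (hprimal.q_balance k).trans (hR.tr_PsiBus hdir hshunt k).symm
        flow := fun k l hkl => by
          rcases hor k l hkl with h1 | h1
          · rw [← hR.P k l h1]
            exact hprimal.flow k l h1
          · rw [hR.tr_Phi_rev hdir h1, N.f_symm k l hkl]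
            exact hprimal.flow_rev l k h1
        voltage := fun k => by
          rw [htv]
          exact hprimal.voltage k
        psd := hW }
  · exact h.gen_nonneg
  · intro k l hkl
    change 0 ≤ (if dir k l then m.mu k l else m.muRev l k)
    rcases hor k l hkl with h1 | h1
    · rw [if_pos h1]
      exact (h.mu_nonneg k l h1).1
    · rw [if_neg (hdir.not_dir h1)]
      exact (h.mu_nonneg l k h1).2
  · exact h.v_nonneg
  · exact hUpsd
  · exact sub_self _
  · exact hgen
  · intro k l hkl
    change (if dir k l then m.mu k l else m.muRev l k) * (tr (N.Phi k l) W - N.f k l) = 0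
    rcases hor k l hkl with h1 | h1
    · rw [if_pos h1, ← hR.P k l h1]
      exact h.cs_flow k l h1
    · rw [if_neg (hdir.not_dir h1), hR.tr_Phi_rev hdir h1, N.f_symm k l hkl]
      exact h.cs_flow_rev l k h1
  · intro k
    rw [htv]
    exact h.cs_vU k
  · intro k
    rw [htv]
    exact h.cs_vL k
  · exact h.cs_qL
  · exact h.cs_qU
  · exact h.cs_pL
  · exact h.cs_pU
  · change tr U W = 0
    rw [htr W z hR]
    exact Finset.sum_eq_zero fun k _ => Finset.sum_eq_zero fun l hl =>
      h.cs_soc k l (Finset.mem_filter.1 hl).2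

end PowerNetwork

theorem theorem4 {n : ℕ} (N : PowerNetwork n)
    (hradial : N.graph.IsAcyclic) (hshunt : ∀ k, N.y k k = 0)
    (dir : Fin n → Fin n → Prop) (hdir : N.IsOrientation dir) :
    N.sdpLMPs = N.socpDLMPs dir :=
  Set.Subset.antisymm (PowerNetwork.sdpLMPs_subset hradial hshunt hdir)
    (PowerNetwork.socpDLMPs_subset hradial hshunt hdir)
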